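/- **Setting.** There are $K$ arms with means $\mu_i\in[0,\bar\mu]$ and $M$ sources; source $j$ has a mean-zero noise law $\mathcal D(j)$ supported in $[-\bar\eta,\bar\eta]$ with standard deviation $\sigma_j$ and fourth central moment $\kappa_j$. In each round $t=1,\dots,T$ the learner picks an arm $i_t$ and a source $j_t$ from the past and observes $X_t=\mu_{i_t}+\varepsilon_t$, where, given the past, $\varepsilon_t\sim\mathcal D(j_t)$. Put $\mu^*=\max_i\mu_i$, $\Delta_i=\mu^*-\mu_i$, $\sigma^*=\min_j\sigma_j$ and $\mathrm{Reg}_T=\sum_{t\le T}(\mu^*-\mu_{i_t})$. **Algorithm SOAR.** Inputs: $\delta\in(0,1)$, $c^*,\nu>0$, integers $\tau_p,\alpha,\beta$, and the value of $\kappa_j$ for those sources for which it is known. (1) *Preprocessing.* Query every source $\tau_p$ times on a fixed arm $i_0$. Let $\hat\mu$ be the mean of the $M\tau_p$ rewards, $\hat\sigma^2_{j,\mathrm{pre}}$ the mean of $(X_s-\hat\mu)^2$ over the queries of $j$, $w=8\bar\eta^2\sqrt{\log(12M/\delta')/\tau_p}$ with $\delta'=\delta/3$, $\mathrm{UCB}^{\mathrm{pre}}(j)=\hat\sigma^2_{j,\mathrm{pre}}+w$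 and $\mathrm{LCB}^{\mathrm{pre}}(j)=\max\{\hat\sigma^2_{j,\mathrm{pre}}-w,0\}$. The set $S_{\mathcal G}$ of surviving sources consists of the $j$ with $\mathrm{LCB}^{\mathrm{pre}}(j)\le\min_k\mathrm{UCB}^{\mathrm{pre}}(k)$. (2) *Initial exploration.* Choose $\bar j\in S_{\mathcal G}$ with $\mathrm{LCB}^{\mathrm{pre}}(\bar j)\ge {c^*}^2/2$ (any $\bar j\in S_{\mathcal G}$ if there is none) and pull each arm $\alpha$ times with source $\bar j$; then query each $j\in S_{\mathcal G}$ $\beta$ times on a fixed arm. (3) *Adaptive phase.* From now on all statistics use the rounds after preprocessing. Let $n_i(t),m_j(t),n_{ij}(t)$ be the numbers of these rounds up to $t$ with arm $i$, with source $j$, with the pair $(i,j)$; let $\hat\mu_i(t),\hat\mu_{ij}(t)$ be the corresponding empirical means, $\hat\sigma_j^2(t)=\frac{1}{m_j(t)-K}\sum_i\sum_{s:(i_s,j_s)=(i,j)}(X_s-\hat\mu_{ij}(t))^2$, and $Q_j(t)=\max\{\kappa_j,\nu\}$ if $\kappa_j$ is known, $Q_j(t)=\max\{\bar\eta^2\hat\sigma_j^2(t),\nu\}$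 otherwise. In every remaining round $t+1$ play $i_{t+1}\in\arg\max_i\mathrm{UCB}_t(i)$ and $j_{t+1}\in\arg\min_{j\in S_{\mathcal G}}\mathrm{LCB}_t(j)$ (ties broken arbitrarily), where $$\mathrm{UCB}_t(i)=\hat\mu_i(t)+\frac{2\sqrt{2\log(3KT/\delta)\sum_j n_{ij}(t)\hat\sigma_j^2(t)}}{n_i(t)},\qquad \mathrm{LCB}_t(j)=\hat\sigma_j^2(t)-2\sqrt{\frac{Q_j(t)\log(3MT/\delta)}{m_j(t)-K}} .$$ **Theorem.** Let $R\ge1$. There are $C>0$ and $q\in\mathbb N$ depending only on $R$ such that the following holds for all $K,M,T\ge1$, all $\delta\in(0,1)$, all $c^*,\nu,\gamma>0$ and every instance as above for which $c^*$ is of the order of the $\sigma_j$ in the sense that $c^*\le R\,\sigma_j$ for all $j$. Run SOAR with an integer budget $\tau_p\ge\max\{1,\tau_{\min}\}$, $\tau_{\min}=\frac{1024\,\bar\eta^4\log(12M/\delta)}{{c^*}^4}$, and $$\alpha=\Big\lceil\frac{\bar\eta^2\log(3KT/\delta)}{{c^*}^2}\Big\rceil,\qquad \beta=\Big\lceil 2K+\frac{4\bar\eta^4\log(3MT/\delta)}{\nu}+\frac{16\bar\eta^4\log(3MT/\delta)}{{c^*}^4}\Big\rceil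 .$$ Put $$E=\frac{M\bar\eta^4\bar\mu}{{c^*}^4}+\frac{K\bar\eta^2\bar\mu}{{c^*}^2}+KM\bar\mu+\frac{M\bar\eta^4\bar\mu}{\nu}+\frac{M\bar\eta^4\bar\mu}{{c^*}^4}+M\bar\mu\,(\tau_p-\tau_{\min}),\qquad \Lambda=C\Big(\log\frac{3KMT}{\delta}\Big)^{q}.$$ Then, with probability at least $1-\delta$: if some $j\in S_{\mathcal G}$ has $\sigma_j^2\ge{c^*}^2$, then both $$\mathrm{Reg}_T\le\Lambda\Bigg(E+\sqrt{K^2M{c^*}^2+\sum_{j\in S_{\mathcal G}:\,\sigma_j-\sigma^*>\gamma}\frac{K\,Q_j(T)}{(\gamma+2\sigma^*)^2}}+\sum_{i:\,\Delta_i>0}\frac{(\sigma^*+\gamma)^2}{\Delta_i}\Bigg)$$ and $$\mathrm{Reg}_T\le\Lambda\Big(E+(\sigma^*+c^*)\sqrt{KT}\Big).$$ -/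

import Mathlib

open MeasureTheory ProbabilityTheory

noncomputable section

/-- One round of interaction: the selected arm, the selected source, the observed reward. -/
abbrev Round (K M : ℕ) : Type := Fin K × Fin M × ℝ

namespace Soar

/-! ### The multi-source bandit model -/

/-- Standard deviation of a noise law. -/
def sd (D : Measure ℝ) : ℝ := Real.sqrt (variance id D)

/-- `σ*`, the smallest standard deviation among the sources. -/
def sdMin {M : ℕ} (D : Fin M → Measure ℝ) : ℝ := ⨅ j, sd (D j)

/-- `Δ_i = μ* - μ_i`, the suboptimality gap of arm `i`. -/
def gap {K : ℕ} (mu : Fin K → ℝ) (i : Fin K) : ℝ := (⨆ k, mu k) - mu i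

/-- An admissible family of noise laws: mean-zero probability laws supported in `[-η, η]`. -/
structure NoiseLaws {M : ℕ} (D : Fin M → Measure ℝ) (eta : ℝ) : Prop where
  prob : ∀ j, IsProbabilityMeasure (D j)
  bounded : ∀ j, ∀ᵐ x ∂(D j), x ∈ Set.Icc (-eta) eta
  centered : ∀ j, ∫ x, x ∂(D j) = 0

/-- The interaction of a (possibly randomized) learner with the bandit. Rounds are numbered from
`0`; `ℱ t` is the information available before round `t`. The pair chosen in round `t` depends on
that information only, and given `ℱ t` the noise `X t - mu (arm t)` has law `D (src t)`. -/
structure Interaction {K M : ℕ} {Ω : Type*} [mΩ : MeasurableSpace Ω] (P : Measure Ω)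
    (ℱ : Filtration ℕ mΩ) (mu : Fin K → ℝ) (D : Fin M → Measure ℝ)
    (arm : ℕ → Ω → Fin K) (src : ℕ → Ω → Fin M) (X : ℕ → Ω → ℝ) : Prop where
  arm_meas : ∀ t, Measurable[ℱ t] (arm t)
  src_meas : ∀ t, Measurable[ℱ t] (src t)
  reward_meas : ∀ t, Measurable[ℱ (t + 1)] (X t)
  noise_law : ∀ (t : ℕ) (j : Fin M) (A : Set Ω) (B : Set ℝ),
    MeasurableSet[ℱ t] A → MeasurableSet B →
      P {ω | ω ∈ A ∧ src t ω = j ∧ X t ω - mu (arm t ω) ∈ B}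
        = P {ω | ω ∈ A ∧ src t ω = j} * D j B

/-- The regret over the first `T` rounds. -/
def regret {K : ℕ} {Ω : Type*} (mu : Fin K → ℝ) (arm : ℕ → Ω → Fin K) (T : ℕ) (ω : Ω) : ℝ :=
  ∑ t ∈ Finset.range T, gap mu (arm t ω)

/-! ### Statistics of the rounds `a, a + 1, …, t - 1` of a trajectory `x` -/

section Statistics

variable {K M : ℕ} (x : ℕ → Round K M) (a t : ℕ)

/-- The rounds in which arm `i` was pulled. -/
def armRounds (i : Fin K) : Finset ℕ := {s ∈ Finset.Ico a t | (x s).1 = i}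

/-- The rounds in which source `j` was queried. -/
def srcRounds (j : Fin M) : Finset ℕ := {s ∈ Finset.Ico a t | (x s).2.1 = j}

/-- The rounds in which arm `i` was pulled with source `j`. -/
def pairRounds (i : Fin K) (j : Fin M) : Finset ℕ :=
  {s ∈ Finset.Ico a t | (x s).1 = i ∧ (x s).2.1 = j}

/-- Empirical mean reward of arm `i`. -/
def armMean (i : Fin K) : ℝ := (∑ s ∈ armRounds x a t i, (x s).2.2) / (armRounds x a t i).card

/-- Empirical mean reward of arm `i` observed through source `j`. -/
def pairMean (i : Fin K) (j : Fin M) : ℝ :=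
  (∑ s ∈ pairRounds x a t i j, (x s).2.2) / (pairRounds x a t i j).card

/-- Pooled variance estimate of source `j`. -/
def pooledVar (j : Fin M) : ℝ :=
  (∑ i, ∑ s ∈ pairRounds x a t i j, ((x s).2.2 - pairMean x a t i j) ^ 2)
    / (((srcRounds x a t j).card : ℝ) - K)

end Statistics

/-! ### The algorithm -/

/-- The inputs of the algorithm: horizon `T`, preprocessing budget `tau`, confidence `delta`,
noise bound `eta`, parameters `c` (that is, `c*`) and `nu`, and the fourth central moments of those
sources for which it is known. -/
structure Params (M : ℕ) where
  T : ℕ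
  tau : ℕ
  delta : ℝ
  eta : ℝ
  c : ℝ
  nu : ℝ
  kappa : Fin M → Option ℝ

namespace Params

variable {K M : ℕ} (p : Params M) (x : ℕ → Round K M)

/-- Number of preprocessing rounds. -/
def prep : ℕ := M * p.tau

/-- Empirical variance of source `j` in the preprocessing phase. -/
def preVar (j : Fin M) : ℝ :=
  (∑ s ∈ srcRounds x 0 p.prep j, ((x s).2.2 - armMean x 0 p.prep (x s).1) ^ 2)
    / (srcRounds x 0 p.prep j).card

/-- Confidence width of the preprocessing phase, run at confidence level `d`. -/
def preWidth (d : ℝ) : ℝ := 8 * p.eta ^ 2 * Real.sqrt (Real.log (12 * M / d) / p.tau)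

def preUCB (d : ℝ) (j : Fin M) : ℝ := p.preVar x j + p.preWidth d

def preLCB (d : ℝ) (j : Fin M) : ℝ := max (p.preVar x j - p.preWidth d) 0

open Classical in
/-- The sources kept by the preprocessing phase, which is called at confidence level `δ / 3`:
a source is dropped when its lower bound exceeds the smallest upper bound. -/
def surviving : Finset (Fin M) :=
  {j | ∀ k, p.preLCB x (p.delta / 3) j ≤ p.preUCB x (p.delta / 3) k}

/-- `log (3 K T / δ)`. -/
def logArm (K : ℕ) : ℝ := Real.log (3 * K * p.T / p.delta)

/-- `log (3 M T / δ)`. -/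
def logSrc : ℝ := Real.log (3 * M * p.T / p.delta)

/-- Initial number of pulls of each arm. -/
def alpha (K : ℕ) : ℕ := ⌈p.eta ^ 2 * p.logArm K / p.c ^ 2⌉₊

/-- Initial number of queries of each surviving source. -/
def beta (K : ℕ) : ℕ :=
  ⌈2 * K + 4 * p.eta ^ 4 * p.logSrc / p.nu + 16 * p.eta ^ 4 * p.logSrc / p.c ^ 4⌉₊

/-- `Q_j(t)`. The estimators of the second stage use the observations made after preprocessing. -/
def Q (t : ℕ) (j : Fin M) : ℝ :=
  match p.kappa j with
  | some k => max k p.nu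
  | none => max (p.eta ^ 2 * pooledVar x p.prep t j) p.nu

/-- Lower confidence bound on the variance of source `j` before round `t`. -/
def LCB (t : ℕ) (j : Fin M) : ℝ :=
  pooledVar x p.prep t j
    - 2 * Real.sqrt (p.Q x t j * p.logSrc / (((srcRounds x p.prep t j).card : ℝ) - K))

/-- Upper confidence bound on the mean of arm `i` before round `t`. -/
def UCB (t : ℕ) (i : Fin K) : ℝ :=
  armMean x p.prep t i
    + 2 * Real.sqrt (2 * p.logArm K *
        ∑ j, ((pairRounds x p.prep t i j).card : ℝ) * pooledVar x p.prep t j)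
      / (armRounds x p.prep t i).card

/-- First round of the second part of the initial exploration. -/
def start₂ (K : ℕ) : ℕ := p.prep + K * p.alpha K

/-- First round of the adaptive phase. -/
def start₃ : ℕ := p.start₂ K + (p.surviving x).card * p.beta K

/-- The trajectory `x` is, during its first `T` rounds, a run of SOAR, with the arm `i₀` used for
preprocessing and the arm `i₁` used for the initial exploration of the sources. Ties, and the
choice of the source `jbar`, are resolved arbitrarily. -/
structure IsRun (i₀ i₁ : Fin K) : Prop where
  /-- Every source is queried `tau` times on arm `i₀`. -/
  preprocess : ∀ t < p.T, t < p.prep → (x t).1 = i₀ ∧ ((x t).2.1 : ℕ) = t / p.tau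
  /-- Every arm is pulled `alpha` times with a surviving source whose preprocessing lower bound is
  at least `c² / 2`, if there is one. -/
  explore_arms : ∃ jbar ∈ p.surviving x,
    ((∃ j ∈ p.surviving x, p.c ^ 2 / 2 ≤ p.preLCB x (p.delta / 3) j) →
      p.c ^ 2 / 2 ≤ p.preLCB x (p.delta / 3) jbar) ∧
    ∀ t < p.T, p.prep ≤ t → t < p.start₂ K →
      ((x t).1 : ℕ) = (t - p.prep) / p.alpha K ∧ (x t).2.1 = jbar
  /-- The surviving sources are queried `beta` times each on arm `i₁`, in increasing order. -/
  explore_sources : ∀ t < p.T, p.start₂ K ≤ t → t < p.start₃ x →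
    (x t).1 = i₁ ∧ (x t).2.1 ∈ p.surviving x ∧
      {k ∈ p.surviving x | k < (x t).2.1}.card = (t - p.start₂ K) / p.beta K
  /-- Afterwards the arm maximizes the upper bound on the mean and the source minimizes the lower
  bound on the variance. -/
  adaptive : ∀ t < p.T, p.start₃ x ≤ t →
    (∀ i, p.UCB x t i ≤ p.UCB x t (x t).1) ∧
    (x t).2.1 ∈ p.surviving x ∧ ∀ j ∈ p.surviving x, p.LCB x t (x t).2.1 ≤ p.LCB x t j

/-- The smallest admissible preprocessing budget, as a real number. -/
def minBudget : ℝ := 1024 * p.eta ^ 4 * Real.log (12 * M / p.delta) / p.c ^ 4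

/-! ### The terms of the regret bounds -/

/-- Preprocessing and exploration terms. The last summand is the cost of a preprocessing budget
above the smallest admissible one. -/
def exploration (K : ℕ) (muBar : ℝ) : ℝ :=
  M * p.eta ^ 4 * muBar / p.c ^ 4 + K * p.eta ^ 2 * muBar / p.c ^ 2 + K * M * muBar
    + M * p.eta ^ 4 * muBar / p.nu + M * p.eta ^ 4 * muBar / p.c ^ 4
    + M * muBar * (p.tau - p.minBudget)

open Classical in
/-- `√(K² M c*² + ∑_{j : σ_j - σ* > γ} K Q_j(T) / (γ + 2 σ*)²)`, over the surviving sources. -/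
def separation (D : Fin M → Measure ℝ) (gamma : ℝ) : ℝ :=
  Real.sqrt ((K : ℝ) ^ 2 * M * p.c ^ 2
    + ∑ j ∈ p.surviving x with gamma < sd (D j) - sdMin D,
        K * p.Q x p.T j / (gamma + 2 * sdMin D) ^ 2)

end Params

open Classical in
/-- `∑ (σ* + γ)² / Δ_i` over the suboptimal arms. -/
def gapSum {K M : ℕ} (mu : Fin K → ℝ) (D : Fin M → Measure ℝ) (gamma : ℝ) : ℝ :=
  ∑ i with 0 < gap mu i, (sdMin D + gamma) ^ 2 / gap mu i

end Soar

end

/-!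
Given the past, each noise variable is a centered bounded law with known variance, so suitable
quadratic expressions in the noise exponentiate to supermartingales. Markov's inequality turns them
into deviation bounds that hold simultaneously with probability at least `1 - δ`. The variance
estimator is centered at means that depend on future rewards; Welford's recursion replaces these by
running means, after which it becomes such an expression.

On the good event the preprocessing widths are at most a fixed fraction of `c²`, so the variances
of the survivors exceed `σ*²` by less than `c²`. Hence, once some survivor has variance at least
`c²`, `σ*²` is itself of order at least `c²` and every survivor has variance at most a constant
multiple of `σ*²`: in the adaptive phase any surviving source is good enough. The initial
exploration uses a source of variance of order at least `c²`, and the initial queries make every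
pooled variance accurate up to a constant factor. Bernstein's inequality for the pulls of an arm
then gives its upper confidence bound a width of order `σ* √(log / n)`, and an arm is pulled
`O(σ*² log / Δ²)` times in the adaptive phase. Summing `n Δ`, directly or by the Cauchy–Schwarz
inequality, gives the gap-dependent and the `√(K T)` bound, while the rounds before the adaptive
phase cost at most the exploration term.
-/

namespace Soar

section Supermartingale

variable {K M : ℕ} {Ω : Type*} [mΩ : MeasurableSpace Ω] {P : Measure Ω}
  {ℱ : Filtration ℕ mΩ} {mu : Fin K → ℝ} {D : Fin M → Measure ℝ}
  {arm : ℕ → Ω → Fin K} {src : ℕ → Ω → Fin M} {X : ℕ → Ω → ℝ}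

/-- The noise `ε_t` of round `t`. -/
def noise (mu : Fin K → ℝ) (arm : ℕ → Ω → Fin K) (X : ℕ → Ω → ℝ) (t : ℕ) (ω : Ω) : ℝ :=
  X t ω - mu (arm t ω)

/-- `∑_{s < t} (k₀ s + k₁ s * ε_s + k₂ s * ε_s ^ 2)` for a sequence `ε`. With predictable
coefficients these are the exponents of all the exponential supermartingales used below. -/
def quadSum (k₀ k₁ k₂ ε : ℕ → Ω → ℝ) (t : ℕ) (ω : Ω) : ℝ :=
  ∑ s ∈ Finset.range t, (k₀ s ω + k₁ s ω * ε s ω + k₂ s ω * ε s ω ^ 2)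

namespace Interaction

lemma measurable_noise_succ (h : Interaction P ℱ mu D arm src X) (t : ℕ) :
    Measurable[ℱ (t + 1)] (noise mu arm X t) :=
  (h.reward_meas t).sub
    ((measurable_of_finite mu).comp ((h.arm_meas t).mono (ℱ.mono t.le_succ) le_rfl))

lemma measurable_noise (h : Interaction P ℱ mu D arm src X) (t : ℕ) :
    Measurable (noise mu arm X t) :=
  (h.measurable_noise_succ t).mono (ℱ.le _) le_rfl

lemma measurableSet_src_eq (h : Interaction P ℱ mu D arm src X) (t : ℕ) (j : Fin M) :
    MeasurableSet[ℱ t] {ω | src t ω = j} :=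
  h.src_meas t (measurableSet_singleton j)

lemma map_restrict_src_eq_prod [IsFiniteMeasure P] [∀ j, SigmaFinite (D j)]
    (h : Interaction P ℱ mu D arm src X) (t : ℕ) (j : Fin M) {α : Type*} [MeasurableSpace α]
    {Y : Ω → α} (hY : Measurable[ℱ t] Y) :
    (P.restrict {ω | src t ω = j}).map (fun ω => (Y ω, noise mu arm X t ω))
      = ((P.restrict {ω | src t ω = j}).map Y).prod (D j) := by
  have hY' : Measurable Y := hY.mono (ℱ.le _) le_rfl
  have hpair := hY'.prodMk (h.measurable_noise t)
  refine (Measure.prod_eq fun A B hA hB => ?_).symm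
  have hset : ((fun ω => (Y ω, noise mu arm X t ω)) ⁻¹' A ×ˢ B) ∩ {ω | src t ω = j}
      = {ω | ω ∈ Y ⁻¹' A ∧ src t ω = j ∧ X t ω - mu (arm t ω) ∈ B} := by
    ext ω
    simp only [Set.mem_inter_iff, Set.mem_preimage, Set.mem_prod, Set.mem_ofPred_eq, noise]
    tauto
  rw [Measure.map_apply hpair (hA.prod hB), Measure.map_apply hY' hA,
    Measure.restrict_apply (hY' hA), Measure.restrict_apply (hpair (hA.prod hB)), hset,
    h.noise_law t j (Y ⁻¹' A) B (hY hA) hB]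
  rfl

theorem lintegral_noise_eq [IsFiniteMeasure P] [∀ j, SigmaFinite (D j)]
    (h : Interaction P ℱ mu D arm src X) (t : ℕ) {α : Type*} [MeasurableSpace α]
    {Y : Ω → α} (hY : Measurable[ℱ t] Y) {G : α → ℝ → ENNReal}
    (hG : Measurable (Function.uncurry G)) :
    ∫⁻ ω, G (Y ω) (noise mu arm X t ω) ∂P = ∫⁻ ω, ∫⁻ e, G (Y ω) e ∂(D (src t ω)) ∂P := by
  have hY' : Measurable Y := hY.mono (ℱ.le _) le_rfl
  have hsrc := fun j => ℱ.le t _ (h.measurableSet_src_eq t j)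
  have hcover : (⋃ j ∈ (Finset.univ : Finset (Fin M)), {ω | src t ω = j}) = Set.univ := by
    ext ω; simp
  have hdisj : Set.PairwiseDisjoint (↑(Finset.univ : Finset (Fin M)))
      fun j => {ω | src t ω = j} := fun i _ j _ hij =>
    Set.disjoint_left.2 fun ω (hi : src t ω = i) hj => hij (hi.symm.trans hj)
  have hsplit (f : Ω → ENNReal) :
      ∫⁻ ω, f ω ∂P = ∑ j, ∫⁻ ω in {ω | src t ω = j}, f ω ∂P := by
    rw [← lintegral_biUnion_finset hdisj (fun j _ => hsrc j), hcover, Measure.restrict_univ]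
  rw [hsplit, hsplit]
  refine Finset.sum_congr rfl fun j _ => ?_
  have hmap := lintegral_map (μ := P.restrict {ω | src t ω = j}) hG
    (hY'.prodMk (h.measurable_noise t))
  rw [h.map_restrict_src_eq_prod t j hY, lintegral_prod _ hG.aemeasurable,
    lintegral_map hG.lintegral_prod_right' hY'] at hmap
  refine hmap.symm.trans (setLIntegral_congr_fun (hsrc j) fun ω (hω : src t ω = j) => ?_)
  simp only [Function.uncurry_apply_pair, hω]

variable {k₀ k₁ k₂ : ℕ → Ω → ℝ}

lemma measurable_quadSum (h : Interaction P ℱ mu D arm src X)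
    (h₀ : ∀ s, Measurable[ℱ s] (k₀ s)) (h₁ : ∀ s, Measurable[ℱ s] (k₁ s))
    (h₂ : ∀ s, Measurable[ℱ s] (k₂ s)) (t : ℕ) :
    Measurable[ℱ t] (quadSum k₀ k₁ k₂ (noise mu arm X) t) := by
  refine Finset.measurable_sum _ fun s hs => ?_
  have hst : s < t := Finset.mem_range.1 hs
  have hε := (h.measurable_noise_succ s).mono (ℱ.mono hst) le_rfl
  exact (((h₀ s).mono (ℱ.mono hst.le) le_rfl).add
    (((h₁ s).mono (ℱ.mono hst.le) le_rfl).mul hε)).add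
    (((h₂ s).mono (ℱ.mono hst.le) le_rfl).mul (hε.pow_const 2))

theorem lintegral_exp_quadSum_le_one [IsProbabilityMeasure P] [∀ j, SigmaFinite (D j)]
    (h : Interaction P ℱ mu D arm src X)
    (h₀ : ∀ s, Measurable[ℱ s] (k₀ s)) (h₁ : ∀ s, Measurable[ℱ s] (k₁ s))
    (h₂ : ∀ s, Measurable[ℱ s] (k₂ s))
    (hmgf : ∀ s ω, ∫⁻ e, ENNReal.ofReal (Real.exp (k₀ s ω + k₁ s ω * e + k₂ s ω * e ^ 2))
      ∂(D (src s ω)) ≤ 1) (t : ℕ) :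
    ∫⁻ ω, ENNReal.ofReal (Real.exp (quadSum k₀ k₁ k₂ (noise mu arm X) t ω)) ∂P ≤ 1 := by
  induction t with
  | zero => simp [quadSum]
  | succ t ih =>
    have hpast : Measurable[ℱ t] fun ω =>
        (quadSum k₀ k₁ k₂ (noise mu arm X) t ω, k₀ t ω, k₁ t ω, k₂ t ω) :=
      (h.measurable_quadSum h₀ h₁ h₂ t).prodMk ((h₀ t).prodMk ((h₁ t).prodMk (h₂ t)))
    have hstep := h.lintegral_noise_eq t hpast
      (G := fun y e => ENNReal.ofReal
        (Real.exp (y.1 + (y.2.1 + y.2.2.1 * e + y.2.2.2 * e ^ 2))))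
      (by unfold Function.uncurry; fun_prop)
    simp only [quadSum, Finset.sum_range_succ] at hstep ih ⊢
    rw [hstep]
    refine (lintegral_mono fun ω => ?_).trans ih
    simp only [Real.exp_add (∑ _ ∈ _, _), ENNReal.ofReal_mul (Real.exp_pos _).le]
    rw [lintegral_const_mul _ (by fun_prop)]
    exact mul_le_of_le_one_right' (hmgf t ω)

theorem measure_lt_quadSum_le [IsProbabilityMeasure P] [∀ j, SigmaFinite (D j)]
    (h : Interaction P ℱ mu D arm src X)
    (h₀ : ∀ s, Measurable[ℱ s] (k₀ s)) (h₁ : ∀ s, Measurable[ℱ s] (k₁ s))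
    (h₂ : ∀ s, Measurable[ℱ s] (k₂ s))
    (hmgf : ∀ s ω, ∫⁻ e, ENNReal.ofReal (Real.exp (k₀ s ω + k₁ s ω * e + k₂ s ω * e ^ 2))
      ∂(D (src s ω)) ≤ 1) (t : ℕ) (x : ℝ) :
    P {ω | x < quadSum k₀ k₁ k₂ (noise mu arm X) t ω} ≤ ENNReal.ofReal (Real.exp (-x)) := by
  have hmeas := (h.measurable_quadSum h₀ h₁ h₂ t).mono (ℱ.le t) le_rfl
  calc P {ω | x < quadSum k₀ k₁ k₂ (noise mu arm X) t ω}
      ≤ P {ω | ENNReal.ofReal (Real.exp x)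
          ≤ ENNReal.ofReal (Real.exp (quadSum k₀ k₁ k₂ (noise mu arm X) t ω))} :=
        measure_mono fun ω hω =>
          ENNReal.ofReal_le_ofReal (Real.exp_le_exp.2 (Set.mem_ofPred_eq ▸ hω).le)
    _ ≤ (∫⁻ ω, ENNReal.ofReal (Real.exp (quadSum k₀ k₁ k₂ (noise mu arm X) t ω)) ∂P)
          / ENNReal.ofReal (Real.exp x) :=
        meas_ge_le_lintegral_div hmeas.exp.ennreal_ofReal.aemeasurable
          (ENNReal.ofReal_pos.2 (Real.exp_pos x)).ne' ENNReal.ofReal_ne_top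
    _ ≤ 1 / ENNReal.ofReal (Real.exp x) := by
        gcongr; exact h.lintegral_exp_quadSum_le_one h₀ h₁ h₂ hmgf t
    _ = ENNReal.ofReal (Real.exp (-x)) := by
        rw [Real.exp_neg, one_div, ENNReal.ofReal_inv_of_pos (Real.exp_pos x)]

end Interaction

end Supermartingale

section ExpInequalities

lemma exp_le_one_add_add_mul_sq {x b : ℝ} (hx : |x| ≤ b) (hb : b ≤ 1) :
    Real.exp x ≤ 1 + x + (1 / 2 + 2 * b / 9) * x ^ 2 := by
  have htaylor := (abs_le.1 (Real.exp_bound (hx.trans hb) (n := 3) (by norm_num))).2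
  norm_num [Finset.sum_range_succ, Nat.factorial] at htaylor
  have hcube : |x| ^ 3 ≤ b * x ^ 2 := by
    rw [pow_succ, sq_abs, mul_comm]; gcongr
  linarith

lemma exp_le_one_add_two_mul {x : ℝ} (h0 : 0 ≤ x) (h1 : x ≤ 1) : Real.exp x ≤ 1 + 2 * x := by
  have h := exp_le_one_add_add_mul_sq (b := 1) (by rwa [abs_of_nonneg h0]) le_rfl
  nlinarith

lemma exp_neg_sq_half_le {v : ℝ} (hv : |v| ≤ 1) :
    Real.exp (-(v ^ 2 / 2)) ≤ 1 - 3 / 8 * v ^ 2 := by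
  have hv2 : v ^ 2 ≤ 1 := (sq_le_one_iff_abs_le_one v).2 hv
  have hy : 0 ≤ v ^ 2 / 2 := by positivity
  rw [Real.exp_neg, inv_le_comm₀ (Real.exp_pos _) (by linarith)]
  refine le_trans ?_ (Real.quadratic_le_exp_of_nonneg hy)
  rw [inv_le_iff_one_le_mul₀ (by linarith)]
  nlinarith [mul_nonneg hy (sub_nonneg.2 hv2), mul_nonneg (mul_nonneg hy hy) (sub_nonneg.2 hv2)]

lemma exp_neg_one_add_sq_half_le {b : ℝ} (hb : 0 ≤ b) :
    Real.exp (-((1 + b) ^ 2 / 2)) ≤ 5 / 8 - 3 / 4 * b + 3 / 8 * b ^ 2 := by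
  have hsqrt_e : (1.6484 : ℝ) ≤ Real.exp (1 / 2) := by
    have := Real.sum_le_exp_of_nonneg (x := 1 / 2) (by norm_num) 6
    norm_num [Finset.sum_range_succ, Nat.factorial] at this ⊢
    linarith
  have hquad := Real.quadratic_le_exp_of_nonneg (x := b + b ^ 2 / 2) (by positivity)
  have hexp : Real.exp ((1 + b) ^ 2 / 2) = Real.exp (1 / 2) * Real.exp (b + b ^ 2 / 2) := by
    rw [← Real.exp_add]; congr 1; ring
  have hpos : 0 < 5 / 8 - 3 / 4 * b + 3 / 8 * b ^ 2 := by nlinarith [sq_nonneg (b - 1)]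
  rw [Real.exp_neg, inv_le_comm₀ (Real.exp_pos _) hpos, hexp]
  have hlower : 1.6484 * (1 + (b + b ^ 2 / 2) + (b + b ^ 2 / 2) ^ 2 / 2)
      ≤ Real.exp (1 / 2) * Real.exp (b + b ^ 2 / 2) := by gcongr
  refine le_trans ?_ hlower
  rw [inv_le_iff_one_le_mul₀ hpos]
  have hb5 : 0 ≤ b ^ 5 := by positivity
  have hb6 : 0 ≤ b ^ 6 := by positivity
  have hlow_degree : 0 ≤ 0.1467 - b + 2 * b ^ 2 - 0.5 * b ^ 3 + 0.625 * b ^ 4 := by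
    nlinarith [sq_nonneg (b - 0.27), sq_nonneg (b ^ 2 - 0.4 * b),
      mul_nonneg hb (sq_nonneg (b - 0.3))]
  nlinarith

lemma exp_neg_sq_sub_half_le {a x : ℝ} (ha : a ∈ Set.Icc 0 1) (hx : x ∈ Set.Icc (-1) 1) :
    Real.exp (-((x - a) ^ 2 / 2)) ≤ 1 + 3 / 8 * (2 * a - a ^ 2) * x - 3 / 8 * x ^ 2 := by
  obtain ⟨ha0, ha1⟩ := ha
  obtain ⟨hx0, hx1⟩ := hx
  rcases le_or_gt |x - a| 1 with hxa | hxa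
  · refine (exp_neg_sq_half_le hxa).trans ?_
    nlinarith [mul_nonneg (sq_nonneg a) (sub_nonneg.2 hx1)]
  · obtain ⟨u, rfl⟩ : ∃ u, x = u - 1 := ⟨x + 1, by ring⟩
    have hu : 0 ≤ u := by linarith
    have hua : u ≤ a := by
      rcases lt_abs.1 hxa with h | h <;> linarith
    have hu1 : u ≤ 1 := hua.trans ha1
    rw [show (u - 1 - a) ^ 2 = (1 + (a - u)) ^ 2 by ring]
    refine (exp_neg_one_add_sq_half_le (sub_nonneg.2 hua)).trans ?_
    nlinarith [mul_nonneg hu (sub_nonneg.2 hua), mul_nonneg (mul_nonneg hu (sub_nonneg.2 hua)) hu,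
      mul_nonneg (mul_nonneg hu (sub_nonneg.2 hua)) (sub_nonneg.2 hu1), mul_nonneg hu ha0,
      mul_nonneg (mul_nonneg hu ha0) (sub_nonneg.2 ha1), mul_nonneg hu (sub_nonneg.2 ha1)]

lemma exists_forall_exp_neg_sq_sub_half_le (a : ℝ) : ∃ B : ℝ, ∀ x ∈ Set.Icc (-1 : ℝ) 1,
    Real.exp (-((x - a) ^ 2 / 2)) ≤ 1 + B * x - 3 / 8 * x ^ 2 := by
  wlog ha : 0 ≤ a generalizing a
  · obtain ⟨B, hB⟩ := this (-a) (by linarith)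
    refine ⟨-B, fun x hx => ?_⟩
    have hneg := hB (-x) ⟨by linarith [hx.2], by linarith [hx.1]⟩
    rw [show (-x - -a) ^ 2 = (x - a) ^ 2 by ring] at hneg
    linarith
  rcases le_total a 1 with ha1 | ha1
  · exact ⟨_, fun x hx => exp_neg_sq_sub_half_le ⟨ha, ha1⟩ hx⟩
  · refine ⟨_, fun x hx =>
      le_trans ?_ (exp_neg_sq_sub_half_le (Set.right_mem_Icc.2 zero_le_one) hx)⟩
    rw [Real.exp_le_exp]
    nlinarith [hx.2]

end ExpInequalities

section NoiseLaw

/-- A centered probability law on `[-eta, eta]`: what `NoiseLaws` requires of each source. -/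
structure CenteredLaw (ν : Measure ℝ) (eta : ℝ) : Prop where
  prob : IsProbabilityMeasure ν
  bounded : ∀ᵐ x ∂ν, x ∈ Set.Icc (-eta) eta
  centered : ∫ x, x ∂ν = 0

lemma NoiseLaws.centeredLaw {M : ℕ} {D : Fin M → Measure ℝ} {eta : ℝ} (h : NoiseLaws D eta)
    (j : Fin M) : CenteredLaw (D j) eta := ⟨h.prob j, h.bounded j, h.centered j⟩

namespace CenteredLaw

variable {ν : Measure ℝ} {eta : ℝ}

lemma eta_nonneg (h : CenteredLaw ν eta) : 0 ≤ eta := by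
  have := h.prob
  obtain ⟨x, hx⟩ := h.bounded.exists
  linarith [hx.1, hx.2]

lemma integrable_id (h : CenteredLaw ν eta) : Integrable (fun x => x) ν := by
  have := h.prob
  exact Integrable.of_mem_Icc _ _ aemeasurable_id h.bounded

lemma ae_sq_mem_Icc (h : CenteredLaw ν eta) : ∀ᵐ x ∂ν, x ^ 2 ∈ Set.Icc 0 (eta ^ 2) := by
  filter_upwards [h.bounded] with x hx
  exact ⟨sq_nonneg x, sq_le_sq' hx.1 hx.2⟩

lemma integrable_sq (h : CenteredLaw ν eta) : Integrable (fun x => x ^ 2) ν := by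
  have := h.prob
  exact Integrable.of_mem_Icc _ _ (by fun_prop) h.ae_sq_mem_Icc

lemma integral_sq (h : CenteredLaw ν eta) : ∫ x, x ^ 2 ∂ν = sd ν ^ 2 := by
  have := h.prob
  rw [sd, Real.sq_sqrt (variance_nonneg _ _),
    variance_of_integral_eq_zero aemeasurable_id h.centered]
  rfl

lemma sd_le (h : CenteredLaw ν eta) : sd ν ≤ eta := by
  have := h.prob
  refine le_of_sq_le_sq ?_ h.eta_nonneg
  calc sd ν ^ 2 = ∫ x, x ^ 2 ∂ν := h.integral_sq.symm
    _ ≤ ∫ _, eta ^ 2 ∂ν :=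
        integral_mono_ae h.integrable_sq (integrable_const _)
          (h.ae_sq_mem_Icc.mono fun x hx => hx.2)
    _ = eta ^ 2 := by simp

lemma integral_quadratic (h : CenteredLaw ν eta) (B C : ℝ) :
    ∫ e, (1 + B * e + C * e ^ 2) ∂ν = 1 + C * sd ν ^ 2 := by
  have := h.prob
  have hlin : Integrable (fun e : ℝ => 1 + B * e) ν :=
    (integrable_const _).add (h.integrable_id.const_mul B)
  rw [integral_add hlin (h.integrable_sq.const_mul C),
    integral_add (integrable_const _) (h.integrable_id.const_mul B),
    integral_const_mul, integral_const_mul, h.centered, h.integral_sq]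
  simp

/-- The linear term `B * e` of the majorant is free, because the law is centered. -/
lemma lintegral_exp_le_one_of_le_quadratic (h : CenteredLaw ν eta) {k₀ k₁ k₂ B C : ℝ}
    (hq : ∀ e ∈ Set.Icc (-eta) eta, Real.exp (k₀ + k₁ * e + k₂ * e ^ 2) ≤ 1 + B * e + C * e ^ 2) :
    ∫⁻ e, ENNReal.ofReal (Real.exp ((k₀ - C * sd ν ^ 2) + k₁ * e + k₂ * e ^ 2)) ∂ν ≤ 1 := by
  have := h.prob
  have hint : Integrable (fun e => 1 + B * e + C * e ^ 2) ν :=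
    ((integrable_const _).add (h.integrable_id.const_mul B)).add (h.integrable_sq.const_mul C)
  have hquad : ∫⁻ e, ENNReal.ofReal (Real.exp (k₀ + k₁ * e + k₂ * e ^ 2)) ∂ν
      ≤ ENNReal.ofReal (1 + C * sd ν ^ 2) := by
    rw [← h.integral_quadratic B C, ofReal_integral_eq_lintegral_ofReal hint
      (h.bounded.mono fun e he => (Real.exp_pos _).le.trans (hq e he))]
    exact lintegral_mono_ae (h.bounded.mono fun e he => ENNReal.ofReal_le_ofReal (hq e he))
  have hfactor (e : ℝ) : Real.exp ((k₀ - C * sd ν ^ 2) + k₁ * e + k₂ * e ^ 2)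
      = Real.exp (-(C * sd ν ^ 2)) * Real.exp (k₀ + k₁ * e + k₂ * e ^ 2) := by
    rw [← Real.exp_add]; congr 1; ring
  simp_rw [hfactor, ENNReal.ofReal_mul (Real.exp_pos _).le]
  rw [lintegral_const_mul _ (by fun_prop)]
  calc _ ≤ ENNReal.ofReal (Real.exp (-(C * sd ν ^ 2)))
          * ENNReal.ofReal (Real.exp (C * sd ν ^ 2)) := by
        gcongr
        refine hquad.trans (ENNReal.ofReal_le_ofReal ?_)
        linarith [Real.add_one_le_exp (C * sd ν ^ 2)]
    _ = 1 := by
        rw [← ENNReal.ofReal_mul (Real.exp_pos _).le, ← Real.exp_add]; simp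

lemma lintegral_exp_hoeffding_le_one (h : CenteredLaw ν eta) {f : ℝ → ℝ} (hf : Measurable f)
    {a b : ℝ} (hb : ∀ᵐ x ∂ν, f x ∈ Set.Icc a b) (l : ℝ) :
    ∫⁻ e, ENNReal.ofReal (Real.exp (l * (f e - ∫ x, f x ∂ν) - l ^ 2 * (b - a) ^ 2 / 8)) ∂ν
      ≤ 1 := by
  have := h.prob
  have hsub := hasSubgaussianMGF_of_mem_Icc hf.aemeasurable hb
  have hmgf : ∫ e, Real.exp (l * (f e - ∫ x, f x ∂ν)) ∂ν
      ≤ Real.exp (l ^ 2 * (b - a) ^ 2 / 8) := by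
    refine (hsub.mgf_le l).trans_eq (congrArg Real.exp ?_)
    push_cast
    rw [Real.norm_eq_abs, div_pow, sq_abs]
    ring
  simp_rw [sub_eq_add_neg _ (l ^ 2 * (b - a) ^ 2 / 8), Real.exp_add,
    ENNReal.ofReal_mul (Real.exp_pos _).le]
  rw [lintegral_mul_const _ (by fun_prop), ← ofReal_integral_eq_lintegral_ofReal
    (hsub.integrable_exp_mul l) (.of_forall fun _ => (Real.exp_pos _).le),
    ← ENNReal.ofReal_mul (integral_nonneg fun _ => (Real.exp_pos _).le), ENNReal.ofReal_le_one,
    Real.exp_neg, mul_inv_le_iff₀ (Real.exp_pos _), one_mul]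
  exact hmgf

/-- Mixing in the exponent `rho ≤ 1` costs nothing by Bernoulli's inequality; `a` is the predictable
guess of the mean, and it may be arbitrarily wrong. -/
lemma lintegral_exp_neg_sq_sub_le_one (h : CenteredLaw ν eta) (he : 0 < eta) {rho : ℝ}
    (h0 : 0 ≤ rho) (h1 : rho ≤ 1) (a : ℝ) :
    ∫⁻ e, ENNReal.ofReal (Real.exp ((-(rho * a ^ 2 / (2 * eta ^ 2))
      + 3 / 8 * rho * sd ν ^ 2 / eta ^ 2) + rho * a / eta ^ 2 * e
      + -(rho / (2 * eta ^ 2)) * e ^ 2)) ∂ν ≤ 1 := by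
  obtain ⟨B, hB⟩ := exists_forall_exp_neg_sq_sub_half_le (a / eta)
  have := h.lintegral_exp_le_one_of_le_quadratic (k₁ := rho * a / eta ^ 2)
    (k₂ := -(rho / (2 * eta ^ 2))) (k₀ := -(rho * a ^ 2 / (2 * eta ^ 2))) (B := rho * B / eta)
    (C := -(3 / 8 * rho / eta ^ 2)) fun e hee => ?_
  · convert this using 6
    ring
  have hx : e / eta ∈ Set.Icc (-1 : ℝ) 1 :=
    ⟨by rw [le_div_iff₀ he]; linarith [hee.1], by rw [div_le_iff₀ he]; linarith [hee.2]⟩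
  have hexp : Real.exp (-(rho * a ^ 2 / (2 * eta ^ 2)) + rho * a / eta ^ 2 * e
      + -(rho / (2 * eta ^ 2)) * e ^ 2) = Real.exp (-((e / eta - a / eta) ^ 2 / 2)) ^ rho := by
    rw [← Real.exp_mul]; congr 1; field_simp; ring
  rw [hexp]
  set q := 1 + B * (e / eta) - 3 / 8 * (e / eta) ^ 2 with hq
  have hq0 : 0 ≤ q := (Real.exp_pos _).le.trans (hB _ hx)
  calc _ ≤ q ^ rho := Real.rpow_le_rpow (Real.exp_pos _).le (hB _ hx) h0
    _ = (1 + (q - 1)) ^ rho := by ring_nf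
    _ ≤ 1 + rho * (q - 1) := rpow_one_add_le_one_add_mul_self (by linarith) h0 h1
    _ = _ := by rw [hq]; field_simp; ring

lemma lintegral_exp_sq_le_one (h : CenteredLaw ν eta) (he : 0 < eta) :
    ∫⁻ e, ENNReal.ofReal (Real.exp (-(2 / eta ^ 2 * sd ν ^ 2) + 0 * e + 1 / eta ^ 2 * e ^ 2)) ∂ν
      ≤ 1 := by
  have := h.lintegral_exp_le_one_of_le_quadratic (k₀ := 0) (k₁ := 0) (k₂ := 1 / eta ^ 2) (B := 0)
    (C := 2 / eta ^ 2) fun e hee => ?_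
  · simpa using this
  have hx : e ^ 2 / eta ^ 2 ≤ 1 := by
    rw [div_le_one (by positivity)]; exact sq_le_sq' hee.1 hee.2
  convert exp_le_one_add_two_mul (by positivity) hx using 1
  · congr 1; ring
  · ring

lemma lintegral_exp_mul_le_one (h : CenteredLaw ν eta) {l : ℝ} (hl : |l| * eta ≤ 1) :
    ∫⁻ e, ENNReal.ofReal (Real.exp (-(l ^ 2 * (1 / 2 + 2 * (|l| * eta) / 9) * sd ν ^ 2) + l * e
      + 0 * e ^ 2)) ∂ν ≤ 1 := by
  have := h.lintegral_exp_le_one_of_le_quadratic (k₀ := 0) (k₁ := l) (k₂ := 0) (B := l)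
    (C := l ^ 2 * (1 / 2 + 2 * (|l| * eta) / 9)) fun e hee => ?_
  · simpa using this
  have hx : |l * e| ≤ |l| * eta := by
    rw [abs_mul]; gcongr; exact abs_le.2 hee
  convert exp_le_one_add_add_mul_sq hx hl using 1
  · congr 1; ring
  · ring

end CenteredLaw

end NoiseLaw

section RunningStatistics

/-- The mean of `y` over a finite set; it is `0` over the empty set. -/
noncomputable def avg {ι : Type*} (y : ι → ℝ) (S : Finset ι) : ℝ := (∑ s ∈ S, y s) / S.card

lemma sum_sq_sub_avg {ι : Type*} (y : ι → ℝ) (S : Finset ι) :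
    ∑ s ∈ S, (y s - avg y S) ^ 2 = ∑ s ∈ S, y s ^ 2 - (∑ s ∈ S, y s) ^ 2 / S.card := by
  rcases S.eq_empty_or_nonempty with rfl | hS
  · simp
  have hcard : (S.card : ℝ) ≠ 0 := by simp [hS.ne_empty]
  simp only [sub_sq, Finset.sum_add_distrib, Finset.sum_sub_distrib, Finset.sum_const,
    nsmul_eq_mul, ← Finset.sum_mul, ← Finset.mul_sum, avg]
  field_simp
  ring

lemma sum_sq_sub_avg_le {ι : Type*} (y : ι → ℝ) (S : Finset ι) :
    ∑ s ∈ S, (y s - avg y S) ^ 2 ≤ ∑ s ∈ S, y s ^ 2 := by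
  rw [sum_sq_sub_avg]
  exact sub_le_self _ (by positivity)

lemma avg_sub_const {ι : Type*} (y : ι → ℝ) {S : Finset ι} (hS : S.Nonempty) (m : ℝ) :
    avg (fun s => y s - m) S = avg y S - m := by
  have hcard : (S.card : ℝ) ≠ 0 := by simp [hS.ne_empty]
  simp only [avg, Finset.sum_sub_distrib, Finset.sum_const, nsmul_eq_mul]
  field_simp

/-- The rounds of `a, …, t - 1` satisfying `p`: the common form of `armRounds`, `srcRounds` and
`pairRounds`. -/
def hits (p : ℕ → Prop) [DecidablePred p] (a t : ℕ) : Finset ℕ := {s ∈ Finset.Ico a t | p s}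

variable {p : ℕ → Prop} [DecidablePred p] {a t : ℕ}

lemma mem_hits {s : ℕ} : s ∈ hits p a t ↔ (a ≤ s ∧ s < t) ∧ p s := by simp [hits]

lemma hits_of_le (h : t ≤ a) : hits p a t = ∅ := by simp [hits, Finset.Ico_eq_empty_of_le h]

lemma hits_succ_of_pos (h : a ≤ t) (hp : p t) : hits p a (t + 1) = insert t (hits p a t) := by
  rw [hits, Finset.insert_Ico_right_eq_Ico_add_one h |>.symm, Finset.filter_insert, if_pos hp]
  rfl

lemma hits_succ_of_neg (hp : ¬ p t) : hits p a (t + 1) = hits p a t := by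
  rcases le_or_gt a t with h | h
  · rw [hits, Finset.insert_Ico_right_eq_Ico_add_one h |>.symm, Finset.filter_insert, if_neg hp]
    rfl
  · rw [hits_of_le h, hits_of_le h.le]

lemma notMem_hits : t ∉ hits p a t := by simp [mem_hits]

lemma hits_mono {u : ℕ} (h : t ≤ u) : hits p a t ⊆ hits p a u :=
  Finset.filter_subset_filter _ (Finset.Ico_subset_Ico_right h)

lemma sum_hits_card (p : ℕ → Prop) [DecidablePred p] (a t : ℕ) (f : ℕ → ℝ) :
    ∑ s ∈ hits p a t, f (hits p a s).card = ∑ n ∈ Finset.range (hits p a t).card, f n := by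
  induction t with
  | zero => simp [hits_of_le]
  | succ t ih =>
    rcases lt_or_ge t a with h | h
    · simp [hits_of_le h]
    by_cases hp : p t
    · rw [hits_succ_of_pos h hp, Finset.sum_insert notMem_hits,
        Finset.card_insert_of_notMem notMem_hits, Finset.sum_range_succ, ih, add_comm]
    · rw [hits_succ_of_neg hp, ih]

lemma filter_range_card_hits_lt {T : ℕ} (h : t ≤ T) :
    {s ∈ Finset.range T | p s ∧ a ≤ s ∧ (hits p a s).card < (hits p a t).card} = hits p a t := by
  ext s
  rw [Finset.mem_filter, mem_hits, Finset.mem_range]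
  constructor
  · rintro ⟨-, hp, ha, hcard⟩
    exact ⟨⟨ha, lt_of_not_ge fun hts => hcard.not_ge (Finset.card_le_card (hits_mono hts))⟩, hp⟩
  · rintro ⟨⟨ha, hst⟩, hp⟩
    exact ⟨hst.trans_le h, hp, ha, Finset.card_lt_card ⟨hits_mono hst.le,
      fun hsub => notMem_hits (hsub (mem_hits.2 ⟨⟨ha, hst⟩, hp⟩))⟩⟩

/-- Welford's recursion: it writes the sum of squares around the final mean in terms of the running
means, which are predictable. -/
theorem sum_sq_sub_avg_hits (p : ℕ → Prop) [DecidablePred p] (a t : ℕ) (y : ℕ → ℝ) :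
    ∑ s ∈ hits p a t, (y s - avg y (hits p a t)) ^ 2
      = ∑ s ∈ hits p a t, ((hits p a s).card : ℝ) / ((hits p a s).card + 1)
          * (y s - avg y (hits p a s)) ^ 2 := by
  induction t with
  | zero => simp [hits_of_le]
  | succ t ih =>
    rcases lt_or_ge t a with h | h
    · simp [hits_of_le h]
    by_cases hp : p t
    · rw [sum_sq_sub_avg] at ih ⊢
      rw [hits_succ_of_pos h hp, Finset.sum_insert notMem_hits, Finset.sum_insert notMem_hits,
        Finset.sum_insert notMem_hits, Finset.card_insert_of_notMem notMem_hits, ← ih, avg]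
      push_cast
      rcases (hits p a t).eq_empty_or_nonempty with hempty | hne
      · simp [hempty]
      · have hcard : ((hits p a t).card : ℝ) ≠ 0 := by simp [hne.ne_empty]
        field_simp
        ring
    · rw [hits_succ_of_neg hp, ih]

end RunningStatistics

section DegreesOfFreedom

/-- `∑_{n < N} n / (n + 1)`, the total weight of `N` observations in Welford's recursion. It plays
the role of the `N - 1` degrees of freedom of an empirical variance. -/
noncomputable def dof (N : ℕ) : ℝ := ∑ n ∈ Finset.range N, (n : ℝ) / (n + 1)

lemma dof_add_le {m N : ℕ} (h : m ≤ N) : dof m + m / (m + 1) * ((N : ℝ) - m) ≤ dof N := by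
  induction N, h using Nat.le_induction with
  | base => simp
  | succ n hmn ih =>
    have hmn' : (m : ℝ) ≤ n := by exact_mod_cast hmn
    have hratio : (m : ℝ) / (m + 1) ≤ n / (n + 1) := by
      rw [div_le_div_iff₀ (by positivity) (by positivity)]; linarith
    have hsucc : dof (n + 1) = dof n + n / (n + 1) := Finset.sum_range_succ _ _
    rw [hsucc]
    push_cast
    linarith

lemma two_thirds_mul_sub_le_dof (N : ℕ) : 2 / 3 * (N : ℝ) - 5 / 6 ≤ dof N := by
  rcases Nat.lt_or_ge N 2 with h | h
  · interval_cases N <;> norm_num [dof, Finset.sum_range_succ]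
  · have hdof := dof_add_le h
    norm_num [dof, Finset.sum_range_succ] at hdof ⊢
    linarith

lemma mul_sub_le_dof_of_le {N : ℕ} (h : 63 ≤ N) : 63 / 64 * (N : ℝ) - 15 / 4 ≤ dof N := by
  refine le_trans ?_ (dof_add_le h)
  norm_num [dof, Finset.sum_range_succ]
  linarith

end DegreesOfFreedom

section Trajectory

variable {K M : ℕ} (mu : Fin K → ℝ) (x : ℕ → Round K M) (a t : ℕ)

/-- The noise of round `s` of a trajectory. -/
def resid (s : ℕ) : ℝ := (x s).2.2 - mu (x s).1

/-- The rounds of `a, …, s - 1` with the same arm and the same source as round `s`. -/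
def peers (s : ℕ) : Finset ℕ := pairRounds x a s (x s).1 (x s).2.1

/-- The weight of round `s` in Welford's recursion. -/
noncomputable def weight (s : ℕ) : ℝ := ((peers x a s).card : ℝ) / ((peers x a s).card + 1)

lemma weight_mem_Icc (s : ℕ) : weight x a s ∈ Set.Icc 0 1 :=
  ⟨by unfold weight; positivity, by unfold weight; rw [div_le_one (by positivity)]; linarith⟩

lemma pairRounds_eq_hits (i : Fin K) (j : Fin M) :
    pairRounds x a t i j = hits (fun s => (x s).1 = i ∧ (x s).2.1 = j) a t := rfl

lemma sum_arm_pairRounds (f : ℕ → ℝ) (j : Fin M) :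
    ∑ i, ∑ s ∈ pairRounds x a t i j, f s = ∑ s ∈ srcRounds x a t j, f s := by
  rw [← Finset.sum_fiberwise (srcRounds x a t j) (fun s => (x s).1) f]
  refine Finset.sum_congr rfl fun i _ => Finset.sum_congr ?_ fun _ _ => rfl
  ext s; simp only [pairRounds, srcRounds, Finset.mem_filter]; tauto

lemma sum_src_pairRounds (f : ℕ → ℝ) (i : Fin K) :
    ∑ j, ∑ s ∈ pairRounds x a t i j, f s = ∑ s ∈ armRounds x a t i, f s := by
  rw [← Finset.sum_fiberwise (armRounds x a t i) (fun s => (x s).2.1) f]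
  refine Finset.sum_congr rfl fun j _ => Finset.sum_congr ?_ fun _ _ => rfl
  ext s; simp only [pairRounds, armRounds, Finset.mem_filter]; tauto

lemma sum_card_pairRounds (j : Fin M) :
    ∑ i, ((pairRounds x a t i j).card : ℝ) = (srcRounds x a t j).card := by
  simpa using sum_arm_pairRounds x a t (fun _ => 1) j

lemma sum_card_pairRounds_mul (i : Fin K) (v : Fin M → ℝ) :
    ∑ j, ((pairRounds x a t i j).card : ℝ) * v j = ∑ s ∈ armRounds x a t i, v (x s).2.1 := by
  rw [← sum_src_pairRounds x a t (fun s => v (x s).2.1) i]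
  refine Finset.sum_congr rfl fun j _ => ?_
  rw [Finset.sum_congr rfl (g := fun _ => v j)
    (fun s hs => by rw [(Finset.mem_filter.1 hs).2.2]), Finset.sum_const, nsmul_eq_mul]

lemma avg_resid_eq {S : Finset ℕ} (hS : S.Nonempty) {i : Fin K} (hi : ∀ s ∈ S, (x s).1 = i) :
    avg (resid mu x) S = avg (fun s => (x s).2.2) S - mu i := by
  rw [← avg_sub_const _ hS, avg, avg,
    Finset.sum_congr rfl fun s hs => by rw [resid, hi s hs]]

lemma armMean_eq (i : Fin K) (h : (armRounds x a t i).Nonempty) :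
    armMean x a t i = mu i + avg (resid mu x) (armRounds x a t i) := by
  rw [avg_resid_eq mu x h fun s hs => (Finset.mem_filter.1 hs).2, add_sub_cancel]
  rfl

lemma sum_sq_sub_pairMean (i : Fin K) (j : Fin M) :
    ∑ s ∈ pairRounds x a t i j, ((x s).2.2 - pairMean x a t i j) ^ 2
      = ∑ s ∈ pairRounds x a t i j,
          (resid mu x s - avg (resid mu x) (pairRounds x a t i j)) ^ 2 := by
  refine Finset.sum_congr rfl fun s hs => ?_
  rw [avg_resid_eq mu x ⟨s, hs⟩ fun u hu => (Finset.mem_filter.1 hu).2.1, resid,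
    (Finset.mem_filter.1 hs).2.1, sub_sub_sub_cancel_right]
  rfl

/-- The sum of squares in the numerator of `pooledVar`. -/
noncomputable def pooledSq (j : Fin M) : ℝ :=
  ∑ i, ∑ s ∈ pairRounds x a t i j, ((x s).2.2 - pairMean x a t i j) ^ 2

lemma pooledSq_eq_sum_weight (j : Fin M) :
    pooledSq x a t j = ∑ s ∈ srcRounds x a t j,
      weight x a s * (resid mu x s - avg (resid mu x) (peers x a s)) ^ 2 := by
  rw [pooledSq, ← sum_arm_pairRounds]
  refine Finset.sum_congr rfl fun i _ => ?_
  rw [sum_sq_sub_pairMean mu, pairRounds_eq_hits, sum_sq_sub_avg_hits]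
  refine Finset.sum_congr rfl fun s hs => ?_
  obtain ⟨-, rfl, rfl⟩ := mem_hits.1 hs
  rfl

lemma pooledSq_le_sum_sq (j : Fin M) :
    pooledSq x a t j ≤ ∑ s ∈ srcRounds x a t j, resid mu x s ^ 2 := by
  rw [pooledSq, ← sum_arm_pairRounds]
  refine Finset.sum_le_sum fun i _ => ?_
  rw [sum_sq_sub_pairMean mu]
  exact sum_sq_sub_avg_le _ _

lemma sum_weight_eq_sum_dof (j : Fin M) :
    ∑ s ∈ srcRounds x a t j, weight x a s = ∑ i, dof (pairRounds x a t i j).card := by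
  rw [← sum_arm_pairRounds]
  refine Finset.sum_congr rfl fun i _ => ?_
  rw [dof, pairRounds_eq_hits, ← sum_hits_card]
  refine Finset.sum_congr rfl fun s hs => ?_
  obtain ⟨-, rfl, rfl⟩ := mem_hits.1 hs
  rfl

lemma le_sum_weight (j : Fin M) (i₁ : Fin K) {B : ℝ} (hB : 128 ≤ B)
    (h : 2 * K + B ≤ ((pairRounds x a t i₁ j).card : ℝ)) :
    2 / 3 * (((srcRounds x a t j).card : ℝ) - K) + 0.298 * B
      ≤ ∑ s ∈ srcRounds x a t j, weight x a s := by
  have hK : (1 : ℝ) ≤ K := by exact_mod_cast Nat.one_le_iff_ne_zero.2 (Fin.pos i₁).ne'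
  rw [sum_weight_eq_sum_dof, ← sum_card_pairRounds, ← Finset.add_sum_erase _ _ (Finset.mem_univ i₁),
    ← Finset.add_sum_erase (a := i₁) _ (fun i => dof _) (Finset.mem_univ i₁)]
  have hi₁ := mul_sub_le_dof_of_le (N := (pairRounds x a t i₁ j).card) (by
    have : (63 : ℝ) ≤ ((pairRounds x a t i₁ j).card : ℝ) := by linarith
    exact_mod_cast this)
  have hrest : ∑ i ∈ Finset.univ.erase i₁, (2 / 3 * ((pairRounds x a t i j).card : ℝ) - 5 / 6)
      ≤ ∑ i ∈ Finset.univ.erase i₁, dof (pairRounds x a t i j).card :=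
    Finset.sum_le_sum fun i _ => two_thirds_mul_sub_le_dof _
  rw [Finset.sum_sub_distrib, ← Finset.mul_sum, Finset.sum_const,
    Finset.card_erase_of_mem (Finset.mem_univ _), Finset.card_univ, Fintype.card_fin,
    nsmul_eq_mul, Nat.cast_sub (Fin.pos i₁), Nat.cast_one] at hrest
  linarith

end Trajectory

section Schedule

variable {K M : ℕ} {p : Params M} {x : ℕ → Round K M} {i₀ i₁ : Fin K}

lemma Params.prep_le_start₂ : p.prep ≤ p.start₂ K := Nat.le_add_right _ _

lemma Params.start₂_le_start₃ : p.start₂ K ≤ p.start₃ x := Nat.le_add_right _ _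

lemma Params.IsRun.armRounds_prep (h : p.IsRun x i₀ i₁) (hT : p.prep ≤ p.T) :
    armRounds x 0 p.prep i₀ = Finset.range p.prep := by
  ext s
  simp only [armRounds, Finset.mem_filter, Finset.mem_Ico, Finset.mem_range, Nat.zero_le,
    true_and, and_iff_left_iff_imp]
  exact fun hs => (h.preprocess s (hs.trans_le hT) hs).1

lemma Params.IsRun.srcRounds_prep (h : p.IsRun x i₀ i₁) (hT : p.prep ≤ p.T) (htau : 1 ≤ p.tau)
    (j : Fin M) : srcRounds x 0 p.prep j = Finset.Ico (j * p.tau) (j * p.tau + p.tau) := by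
  have hj : (j : ℕ) * p.tau + p.tau ≤ p.prep := by
    rw [Params.prep, ← Nat.succ_mul]
    exact Nat.mul_le_mul_right _ j.2
  ext s
  simp only [srcRounds, Finset.mem_filter, Finset.mem_Ico, Nat.zero_le, true_and]
  constructor
  · rintro ⟨hs, hsrc⟩
    rw [← hsrc, (h.preprocess s (hs.trans_le hT) hs).2]
    exact ⟨Nat.div_mul_le_self _ _, Nat.lt_div_mul_add htau⟩
  · rintro ⟨hle, hlt⟩
    have hs : s < p.prep := hlt.trans_le hj
    refine ⟨hs, Fin.ext ?_⟩
    rw [(h.preprocess s (hs.trans_le hT) hs).2]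
    exact Nat.div_eq_of_lt_le hle (by rwa [Nat.succ_mul])

lemma Params.IsRun.card_srcRounds_prep (h : p.IsRun x i₀ i₁) (hT : p.prep ≤ p.T)
    (htau : 1 ≤ p.tau) (j : Fin M) : (srcRounds x 0 p.prep j).card = p.tau := by
  rw [h.srcRounds_prep hT htau, Nat.card_Ico, Nat.add_sub_cancel_left]

lemma Params.IsRun.src_mem (h : p.IsRun x i₀ i₁) {t : ℕ} (hprep : p.prep ≤ t) (hT : t < p.T) :
    (x t).2.1 ∈ p.surviving x := by
  rcases Nat.lt_or_ge t (p.start₂ K) with h₂ | h₂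
  · obtain ⟨jbar, hj, -, hrounds⟩ := h.explore_arms
    rwa [(hrounds t hT hprep h₂).2]
  rcases Nat.lt_or_ge t (p.start₃ x) with h₃ | h₃
  · exact (h.explore_sources t hT h₂ h₃).2.1
  · exact (h.adaptive t hT h₃).2.1

lemma Params.IsRun.exists_alpha_le_card (h : p.IsRun x i₀ i₁) :
    ∃ jbar ∈ p.surviving x,
      ((∃ j ∈ p.surviving x, p.c ^ 2 / 2 ≤ p.preLCB x (p.delta / 3) j) →
        p.c ^ 2 / 2 ≤ p.preLCB x (p.delta / 3) jbar) ∧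
      ∀ t, p.start₂ K ≤ t → p.start₂ K ≤ p.T → ∀ i,
        p.alpha K ≤ (pairRounds x p.prep t i jbar).card := by
  obtain ⟨jbar, hj, hlcb, hrounds⟩ := h.explore_arms
  refine ⟨jbar, hj, hlcb, fun t ht hT i => ?_⟩
  have hi : p.prep + i * p.alpha K + p.alpha K ≤ p.start₂ K := by
    rw [Params.start₂, add_assoc, ← Nat.succ_mul]
    exact Nat.add_le_add_left (Nat.mul_le_mul_right _ i.2) _
  have hsub : Finset.Ico (p.prep + i * p.alpha K) (p.prep + i * p.alpha K + p.alpha K)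
      ⊆ pairRounds x p.prep t i jbar := by
    intro s hs
    rw [Finset.mem_Ico] at hs
    have hprep : p.prep ≤ s := le_trans (Nat.le_add_right _ _) hs.1
    have hs₂ : s < p.start₂ K := hs.2.trans_le hi
    have hs_round := hrounds s (hs₂.trans_le hT) hprep hs₂
    rw [pairRounds, Finset.mem_filter, Finset.mem_Ico]
    refine ⟨⟨hprep, hs₂.trans_le ht⟩, Fin.ext ?_, hs_round.2⟩
    rw [hs_round.1]
    exact Nat.div_eq_of_lt_le (by lia) (by rw [Nat.succ_mul]; lia)
  simpa using Finset.card_le_card hsub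

lemma card_filter_lt_lt_card {α : Type*} [LinearOrder α] {S : Finset α} {j : α} (hj : j ∈ S) :
    {l ∈ S | l < j}.card < S.card :=
  Finset.card_lt_card (Finset.filter_ssubset.2 ⟨j, hj, lt_irrefl j⟩)

lemma strictMonoOn_card_filter_lt {α : Type*} [LinearOrder α] (S : Finset α) :
    StrictMonoOn (fun j => {l ∈ S | l < j}.card) S := by
  refine fun j hj k _ hjk => Finset.card_lt_card ⟨fun l hl => ?_, fun hsub => ?_⟩
  · rw [Finset.mem_filter] at hl ⊢
    exact ⟨hl.1, hl.2.trans hjk⟩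
  · exact lt_irrefl _ (Finset.mem_filter.1 (hsub (Finset.mem_filter.2 ⟨hj, hjk⟩))).2

lemma Params.IsRun.beta_le_card (h : p.IsRun x i₀ i₁) {t : ℕ}
    (ht : p.start₃ x ≤ t) (hT : p.start₃ x ≤ p.T) {j : Fin M} (hj : j ∈ p.surviving x) :
    p.beta K ≤ (pairRounds x p.prep t i₁ j).card := by
  set rank := {l ∈ p.surviving x | l < j}.card
  have hend : p.start₂ K + rank * p.beta K + p.beta K ≤ p.start₃ x := by
    rw [Params.start₃, add_assoc, ← Nat.succ_mul]
    exact Nat.add_le_add_left (Nat.mul_le_mul_right _ (card_filter_lt_lt_card hj)) _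
  have hsub : Finset.Ico (p.start₂ K + rank * p.beta K)
      (p.start₂ K + rank * p.beta K + p.beta K) ⊆ pairRounds x p.prep t i₁ j := by
    intro s hs
    rw [Finset.mem_Ico] at hs
    have hs₂ : p.start₂ K ≤ s := le_trans (Nat.le_add_right _ _) hs.1
    have hs₃ : s < p.start₃ x := hs.2.trans_le hend
    obtain ⟨harm, hmem, hblock⟩ := h.explore_sources s (hs₃.trans_le hT) hs₂ hs₃
    have hdiv : (s - p.start₂ K) / p.beta K = rank :=
      Nat.div_eq_of_lt_le (by lia) (by rw [Nat.succ_mul]; lia)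
    rw [hdiv] at hblock
    rw [pairRounds, Finset.mem_filter, Finset.mem_Ico]
    exact ⟨⟨Params.prep_le_start₂.trans hs₂, hs₃.trans_le ht⟩, harm,
      (strictMonoOn_card_filter_lt _).injOn hmem hj hblock⟩
  simpa using Finset.card_le_card hsub

end Schedule

section Exponents

variable {K M : ℕ} (mu : Fin K → ℝ) (D : Fin M → Measure ℝ) (eta : ℝ) (x : ℕ → Round K M)
  (a t : ℕ)

/-- The exponent of Hoeffding's supermartingale with tilt `l`, for the squared noise of the
queries of source `j`. -/
noncomputable def sqExponent (j : Fin M) (l : ℝ) : ℝ :=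
  ∑ s ∈ srcRounds x a t j,
    (l * (resid mu x s ^ 2 - sd (D j) ^ 2) - l ^ 2 * (eta ^ 2) ^ 2 / 8)

/-- The exponent of Hoeffding's supermartingale with tilt `l`, for the noise of the queries of
source `j`. -/
noncomputable def meanExponent (j : Fin M) (l : ℝ) : ℝ :=
  ∑ s ∈ srcRounds x a t j, (l * resid mu x s - l ^ 2 * (2 * eta) ^ 2 / 8)

/-- The exponent of a supermartingale that is small only if the weighted sum of squares in
Welford's recursion for source `j` is not much smaller than its mean. -/
noncomputable def lowerVarExponent (j : Fin M) : ℝ :=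
  ∑ s ∈ srcRounds x a t j, (3 / 8 * weight x a s * sd (D j) ^ 2 / eta ^ 2
    - weight x a s * (resid mu x s - avg (resid mu x) (peers x a s)) ^ 2 / (2 * eta ^ 2))

/-- The exponent of a supermartingale that is small only if the sum of the squared noises of
source `j` is at most of the order of its mean. -/
noncomputable def upperVarExponent (j : Fin M) : ℝ :=
  ∑ s ∈ srcRounds x a t j, (resid mu x s ^ 2 / eta ^ 2 - 2 / eta ^ 2 * sd (D j) ^ 2)

/-- The rounds of `a, …, t - 1` in which arm `i` is pulled, up to the `N`-th one. Membership of a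
round is decided by its past and its arm, so that sums over these rounds are martingales even
though the `N`-th pull occurs at a random time. -/
def firstPulls (i : Fin K) (N : ℕ) : Finset ℕ :=
  {s ∈ Finset.range t | (x s).1 = i ∧ a ≤ s ∧ (armRounds x a s i).card < N}

/-- The exponent of Bernstein's supermartingale with tilt `l`, for the noise of the first `N`
pulls of arm `i`. -/
noncomputable def armExponent (i : Fin K) (N : ℕ) (l : ℝ) : ℝ :=
  ∑ s ∈ firstPulls x a t i N, (l * resid mu x s
    - l ^ 2 * (1 / 2 + 2 * (|l| * eta) / 9) * sd (D (x s).2.1) ^ 2)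

lemma srcRounds_eq_filter_range (j : Fin M) :
    srcRounds x a t j = {s ∈ Finset.range t | a ≤ s ∧ (x s).2.1 = j} := by
  ext s
  simp only [srcRounds, Finset.mem_filter, Finset.mem_Ico, Finset.mem_range]
  tauto

end Exponents

section Deviations

/-- The trajectory of an interaction. -/
def traj {K M : ℕ} {Ω : Type*} (arm : ℕ → Ω → Fin K) (src : ℕ → Ω → Fin M) (X : ℕ → Ω → ℝ)
    (ω : Ω) : ℕ → Round K M :=
  fun t => (arm t ω, src t ω, X t ω)

lemma resid_traj {K M : ℕ} {Ω : Type*} (mu : Fin K → ℝ) (arm : ℕ → Ω → Fin K)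
    (src : ℕ → Ω → Fin M) (X : ℕ → Ω → ℝ) (s : ℕ) (ω : Ω) :
    resid mu (traj arm src X ω) s = noise mu arm X s ω :=
  rfl

variable {K M : ℕ} {Ω : Type*} [mΩ : MeasurableSpace Ω] {P : Measure Ω}
  {ℱ : Filtration ℕ mΩ} {mu : Fin K → ℝ} {D : Fin M → Measure ℝ} {eta : ℝ}
  {arm : ℕ → Ω → Fin K} {src : ℕ → Ω → Fin M} {X : ℕ → Ω → ℝ}

namespace Interaction

lemma measurableSet_le_src_eq (h : Interaction P ℱ mu D arm src X) (a s : ℕ) (j : Fin M) :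
    MeasurableSet[ℱ s] {ω | a ≤ s ∧ src s ω = j} :=
  (MeasurableSet.const _).inter (h.measurableSet_src_eq s j)

lemma measurableSet_arm_eq (h : Interaction P ℱ mu D arm src X) (t : ℕ) (i : Fin K) :
    MeasurableSet[ℱ t] {ω | arm t ω = i} := h.arm_meas t (measurableSet_singleton i)

lemma measurable_card_armRounds (h : Interaction P ℱ mu D arm src X) (a s : ℕ) (i : Fin K) :
    Measurable[ℱ s] fun ω => (armRounds (traj arm src X ω) a s i).card := by
  simp_rw [armRounds, Finset.card_filter]
  refine Finset.measurable_sum _ fun u hu => Measurable.ite ?_ measurable_const measurable_const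
  exact ℱ.mono (Finset.mem_Ico.1 hu).2.le _ (h.measurableSet_arm_eq u i)

lemma measurableSet_arm_src_eq (h : Interaction P ℱ mu D arm src X) {u s : ℕ} (hu : u ≤ s) :
    MeasurableSet[ℱ s] {ω | arm u ω = arm s ω ∧ src u ω = src s ω} :=
  (measurableSet_eq_fun ((h.arm_meas u).mono (ℱ.mono hu) le_rfl) (h.arm_meas s)).inter
    (measurableSet_eq_fun ((h.src_meas u).mono (ℱ.mono hu) le_rfl) (h.src_meas s))

lemma measurable_sum_peers (h : Interaction P ℱ mu D arm src X) (a s : ℕ)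
    {f : ℕ → Ω → ℝ} (hf : ∀ u < s, Measurable[ℱ s] (f u)) :
    Measurable[ℱ s] fun ω => ∑ u ∈ peers (traj arm src X ω) a s, f u ω := by
  simp_rw [peers, pairRounds, Finset.sum_filter]
  refine Finset.measurable_sum _ fun u hu => ?_
  have hus := (Finset.mem_Ico.1 hu).2
  exact Measurable.ite (h.measurableSet_arm_src_eq hus.le) (hf u hus) measurable_const

lemma measurable_card_peers (h : Interaction P ℱ mu D arm src X) (a s : ℕ) :
    Measurable[ℱ s] fun ω => ((peers (traj arm src X ω) a s).card : ℝ) := by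
  simpa using h.measurable_sum_peers a s (f := fun _ _ => 1) fun _ _ => measurable_const

lemma measurable_weight (h : Interaction P ℱ mu D arm src X) (a s : ℕ) :
    Measurable[ℱ s] fun ω => weight (traj arm src X ω) a s :=
  (h.measurable_card_peers a s).div ((h.measurable_card_peers a s).add measurable_const)

lemma measurable_avg_peers (h : Interaction P ℱ mu D arm src X) (a s : ℕ) :
    Measurable[ℱ s] fun ω => avg (resid mu (traj arm src X ω)) (peers (traj arm src X ω) a s) :=
  (h.measurable_sum_peers a s fun u hu =>
    (h.measurable_noise_succ u).mono (ℱ.mono hu) le_rfl).div (h.measurable_card_peers a s)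

variable [IsProbabilityMeasure P]

lemma measure_lt_sum_filter_le [∀ j, IsProbabilityMeasure (D j)]
    (h : Interaction P ℱ mu D arm src X)
    {c : ℕ → Ω → Prop} [∀ s ω, Decidable (c s ω)] (hc : ∀ s, MeasurableSet[ℱ s] {ω | c s ω})
    {k₀ k₁ k₂ : ℕ → Ω → ℝ} (h₀ : ∀ s, Measurable[ℱ s] (k₀ s)) (h₁ : ∀ s, Measurable[ℱ s] (k₁ s))
    (h₂ : ∀ s, Measurable[ℱ s] (k₂ s))
    (hmgf : ∀ s ω, c s ω → ∫⁻ e, ENNReal.ofReal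
      (Real.exp (k₀ s ω + k₁ s ω * e + k₂ s ω * e ^ 2)) ∂(D (src s ω)) ≤ 1) (t : ℕ) (y : ℝ) :
    P {ω | y < ∑ s ∈ Finset.range t with c s ω, (k₀ s ω + k₁ s ω * noise mu arm X s ω
      + k₂ s ω * noise mu arm X s ω ^ 2)} ≤ ENNReal.ofReal (Real.exp (-y)) := by
  have hite : ∀ k : ℕ → Ω → ℝ, (∀ s, Measurable[ℱ s] (k s)) →
      ∀ s, Measurable[ℱ s] (fun ω => if c s ω then k s ω else 0) := fun k hk s =>
    Measurable.ite (hc s) (hk s) measurable_const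
  convert h.measure_lt_quadSum_le (hite k₀ h₀) (hite k₁ h₁) (hite k₂ h₂) (fun s ω => ?_) t y
    using 5 with ω
  · rw [Finset.sum_filter]
    refine Finset.sum_congr rfl fun s _ => ?_
    by_cases hcs : c s ω <;> simp [hcs]
  · by_cases hcs : c s ω
    · simpa only [if_pos hcs] using hmgf s ω hcs
    · simp [hcs]

theorem measure_lt_sqExponent_le (h : Interaction P ℱ mu D arm src X) (hD : NoiseLaws D eta)
    (a t : ℕ) (j : Fin M) (l y : ℝ) :
    P {ω | y < sqExponent mu D eta (traj arm src X ω) a t j l}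
      ≤ ENNReal.ofReal (Real.exp (-y)) := by
  have := hD.prob
  have hlaw := hD.centeredLaw j
  convert h.measure_lt_sum_filter_le (h.measurableSet_le_src_eq a · j)
    (k₀ := fun _ _ => -(l * sd (D j) ^ 2) - l ^ 2 * (eta ^ 2) ^ 2 / 8) (k₁ := fun _ _ => 0)
    (k₂ := fun _ _ => l) (fun _ => measurable_const) (fun _ => measurable_const)
    (fun _ => measurable_const) (fun s ω hs => ?_) t y using 5 with ω
  · rw [sqExponent, srcRounds_eq_filter_range]
    exact Finset.sum_congr rfl fun s _ => by rw [resid_traj]; ring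
  · rw [hs.2]
    convert hlaw.lintegral_exp_hoeffding_le_one (f := fun e => e ^ 2) (by fun_prop)
      hlaw.ae_sq_mem_Icc l using 5 with e
    rw [hlaw.integral_sq]
    ring

theorem measure_lt_meanExponent_le (h : Interaction P ℱ mu D arm src X) (hD : NoiseLaws D eta)
    (a t : ℕ) (j : Fin M) (l y : ℝ) :
    P {ω | y < meanExponent mu eta (traj arm src X ω) a t j l}
      ≤ ENNReal.ofReal (Real.exp (-y)) := by
  have := hD.prob
  have hlaw := hD.centeredLaw j
  convert h.measure_lt_sum_filter_le (h.measurableSet_le_src_eq a · j)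
    (k₀ := fun _ _ => -(l ^ 2 * (2 * eta) ^ 2 / 8)) (k₁ := fun _ _ => l)
    (k₂ := fun _ _ => 0) (fun _ => measurable_const) (fun _ => measurable_const)
    (fun _ => measurable_const) (fun s ω hs => ?_) t y using 5 with ω
  · rw [meanExponent, srcRounds_eq_filter_range]
    exact Finset.sum_congr rfl fun s _ => by rw [resid_traj]; ring
  · rw [hs.2]
    convert hlaw.lintegral_exp_hoeffding_le_one (f := fun e => e) (by fun_prop)
      hlaw.bounded l using 5 with e
    rw [hlaw.centered]
    ring

theorem measure_lt_lowerVarExponent_le (h : Interaction P ℱ mu D arm src X)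
    (hD : NoiseLaws D eta) (heta : 0 < eta) (a t : ℕ) (j : Fin M) (y : ℝ) :
    P {ω | y < lowerVarExponent mu D eta (traj arm src X ω) a t j}
      ≤ ENNReal.ofReal (Real.exp (-y)) := by
  have := hD.prob
  have hw := h.measurable_weight a
  have hm := h.measurable_avg_peers a
  set w : ℕ → Ω → ℝ := fun s ω => weight (traj arm src X ω) a s with hw_def
  set m : ℕ → Ω → ℝ := fun s ω => avg (resid mu (traj arm src X ω))
    (peers (traj arm src X ω) a s) with hm_def
  convert h.measure_lt_sum_filter_le (h.measurableSet_le_src_eq a · j)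
    (k₀ := fun s ω => -(w s ω * m s ω ^ 2 / (2 * eta ^ 2))
      + 3 / 8 * w s ω * sd (D j) ^ 2 / eta ^ 2)
    (k₁ := fun s ω => w s ω * m s ω / eta ^ 2)
    (k₂ := fun s ω => -(w s ω / (2 * eta ^ 2)))
    (fun s => ((((hw s).mul ((hm s).pow_const 2)).div_const _).neg).add
      ((((hw s).const_mul _).mul_const _).div_const _))
    (fun s => ((hw s).mul (hm s)).div_const _) (fun s => ((hw s).div_const _).neg)
    (fun s ω hs => ?_) t y using 5 with ω
  · rw [lowerVarExponent, srcRounds_eq_filter_range]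
    refine Finset.sum_congr rfl fun s _ => ?_
    simp only [hw_def, hm_def, resid_traj]
    field_simp
    ring
  · rw [hs.2]
    exact (hD.centeredLaw j).lintegral_exp_neg_sq_sub_le_one heta (weight_mem_Icc _ _ _).1
      (weight_mem_Icc _ _ _).2 _

theorem measure_lt_upperVarExponent_le (h : Interaction P ℱ mu D arm src X)
    (hD : NoiseLaws D eta) (heta : 0 < eta) (a t : ℕ) (j : Fin M) (y : ℝ) :
    P {ω | y < upperVarExponent mu D eta (traj arm src X ω) a t j}
      ≤ ENNReal.ofReal (Real.exp (-y)) := by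
  have := hD.prob
  convert h.measure_lt_sum_filter_le (h.measurableSet_le_src_eq a · j)
    (k₀ := fun _ _ => -(2 / eta ^ 2 * sd (D j) ^ 2)) (k₁ := fun _ _ => 0)
    (k₂ := fun _ _ => 1 / eta ^ 2) (fun _ => measurable_const) (fun _ => measurable_const)
    (fun _ => measurable_const) (fun s ω hs => ?_) t y using 5 with ω
  · rw [upperVarExponent, srcRounds_eq_filter_range]
    exact Finset.sum_congr rfl fun s _ => by rw [resid_traj]; ring
  · rw [hs.2]
    exact (hD.centeredLaw j).lintegral_exp_sq_le_one heta

theorem measure_lt_armExponent_le (h : Interaction P ℱ mu D arm src X)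
    (hD : NoiseLaws D eta) {l : ℝ} (hl : |l| * eta ≤ 1) (a t : ℕ) (i : Fin K) (N : ℕ) (y : ℝ) :
    P {ω | y < armExponent mu D eta (traj arm src X ω) a t i N l}
      ≤ ENNReal.ofReal (Real.exp (-y)) := by
  have := hD.prob
  set cost : Fin M → ℝ := fun j => -(l ^ 2 * (1 / 2 + 2 * (|l| * eta) / 9) * sd (D j) ^ 2)
  convert h.measure_lt_sum_filter_le
    (c := fun s ω => arm s ω = i ∧ a ≤ s ∧ (armRounds (traj arm src X ω) a s i).card < N)
    (fun s => (h.measurableSet_arm_eq s i).inter ((MeasurableSet.const _).inter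
      ((h.measurable_card_armRounds a s i) (measurableSet_Iio (a := N)))))
    (k₀ := fun s ω => cost (src s ω)) (k₁ := fun _ _ => l) (k₂ := fun _ _ => 0)
    (fun s => (measurable_of_finite cost).comp (h.src_meas s)) (fun _ => measurable_const)
    (fun _ => measurable_const) (fun s ω _ => ?_) t y using 5 with ω
  · exact Finset.sum_congr rfl fun s _ => by rw [resid_traj]; simp only [cost, traj]; ring
  · exact (hD.centeredLaw _).lintegral_exp_mul_le_one hl

end Interaction

end Deviations

section Concentration

variable {K M : ℕ} (p : Params M) (mu : Fin K → ℝ) (D : Fin M → Measure ℝ)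

/-- `log (36 M / δ)`, the confidence exponent of the preprocessing phase. -/
noncomputable def Params.logPre : ℝ := Real.log (12 * M / (p.delta / 3))

/-- `√(log (36 M / δ) / τ)`, the preprocessing confidence width up to the factor `8 η²`. -/
noncomputable def Params.preRate : ℝ := Real.sqrt (p.logPre / p.tau)

/-- `N σ*² / (η² log (3 K T / δ))`, the variance of `N` pulls of an arm with the best source in
the units of Bernstein's inequality. -/
noncomputable def Params.scale (K N : ℕ) : ℝ := N * sdMin D ^ 2 / (p.logArm K * p.eta ^ 2)

/-- The exponent, in units of `1 / η`, at which Bernstein's supermartingale is evaluated for `N`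
pulls of an arm. Where `scale` vanishes, the junk value `z / 0 = 0` is harmless. -/
noncomputable def Params.tilt (K : ℕ) (z : ℝ) (N : ℕ) : ℝ :=
  min 1 (z / Real.sqrt (p.scale D K N))

/-- The deviation bounds on which the analysis of a trajectory rests; `i` is meant to be an
optimal arm, whose mean must not be underestimated. The constants in the tilts optimize the
resulting bounds. -/
structure Concentrated (x : ℕ → Round K M) (i : Fin K) : Prop where
  pre_sq : ∀ l ∈ ({2.8, -2.8} : Finset ℝ), ∀ j,
    sqExponent mu D p.eta x 0 p.prep j (l * p.preRate / p.eta ^ 2) ≤ p.logPre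
  pre_mean : ∀ l ∈ ({1.4, -1.4} : Finset ℝ), ∀ j,
    meanExponent mu p.eta x 0 p.prep j (l * p.preRate / p.eta) ≤ p.logPre
  var_lower : ∀ j, ∀ t < p.T, lowerVarExponent mu D p.eta x p.prep t j ≤ p.logSrc
  var_upper : ∀ j, ∀ t < p.T, upperVarExponent mu D p.eta x p.prep t j ≤ 2 * p.logSrc
  best_lower : ∀ N < p.T,
    armExponent mu D p.eta x p.prep p.T i N (-(p.tilt D K 0.9 N / p.eta)) ≤ p.logArm K
  arm_upper : ∀ k, ∀ N < p.T,
    armExponent mu D p.eta x p.prep p.T k N (p.tilt D K 1 N / p.eta) ≤ 2 * p.logArm K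

variable {p}

lemma Params.tilt_nonneg {z : ℝ} (hz : 0 ≤ z) (N : ℕ) : 0 ≤ p.tilt D K z N :=
  le_min zero_le_one (by positivity)

lemma Params.tilt_le_one (z : ℝ) (N : ℕ) : p.tilt D K z N ≤ 1 := min_le_left _ _

lemma Params.abs_tilt_div_mul (heta : 0 < p.eta) {z : ℝ} (hz : 0 ≤ z) (N : ℕ) :
    |p.tilt D K z N / p.eta| * p.eta = p.tilt D K z N := by
  rw [abs_of_nonneg (div_nonneg (p.tilt_nonneg D hz N) heta.le), div_mul_cancel₀ _ heta.ne']

lemma Params.exp_neg_logPre (hdelta : 0 < p.delta) (hM : 0 < M) :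
    Real.exp (-p.logPre) = p.delta / (36 * M) := by
  rw [logPre, Real.exp_neg, Real.exp_log (by positivity)]
  field_simp
  norm_num

lemma Params.exp_neg_logSrc (hdelta : 0 < p.delta) (hM : 0 < M) (hT : 0 < p.T) :
    Real.exp (-p.logSrc) = p.delta / (3 * M * p.T) := by
  rw [logSrc, Real.exp_neg, Real.exp_log (by positivity), inv_div]

lemma Params.exp_neg_logArm (hdelta : 0 < p.delta) (hK : 0 < K) (hT : 0 < p.T) :
    Real.exp (-p.logArm K) = p.delta / (3 * K * p.T) := by
  rw [logArm, Real.exp_neg, Real.exp_log (by positivity), inv_div]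

end Concentration

section UnionBound

variable {Ω : Type*} [mΩ : MeasurableSpace Ω] {P : Measure Ω}

lemma measure_not_forall_le {ι : Type*} (S : Finset ι) {f : ι → Ω → ℝ} {y q : ℝ}
    (H : ∀ a ∈ S, P {ω | y < f a ω} ≤ ENNReal.ofReal (Real.exp (-y)))
    (hq : S.card * Real.exp (-y) ≤ q) :
    P {ω | ¬ ∀ a ∈ S, f a ω ≤ y} ≤ ENNReal.ofReal q := by
  have hunion : {ω | ¬ ∀ a ∈ S, f a ω ≤ y} = ⋃ a ∈ S, {ω | y < f a ω} := by
    ext ω; simp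
  rw [hunion]
  calc P (⋃ a ∈ S, {ω | y < f a ω}) ≤ ∑ a ∈ S, P {ω | y < f a ω} :=
        measure_biUnion_finset_le _ _
    _ ≤ ∑ _a ∈ S, ENNReal.ofReal (Real.exp (-y)) := Finset.sum_le_sum H
    _ = ENNReal.ofReal (S.card * Real.exp (-y)) := by
        rw [Finset.sum_const, nsmul_eq_mul, ENNReal.ofReal_mul (by positivity),
          ENNReal.ofReal_natCast]
    _ ≤ ENNReal.ofReal q := ENNReal.ofReal_le_ofReal hq

lemma measure_not_and_le {A B : Ω → Prop} {q r : ℝ} (hq : 0 ≤ q) (hr : 0 ≤ r)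
    (hA : P {ω | ¬ A ω} ≤ ENNReal.ofReal q) (hB : P {ω | ¬ B ω} ≤ ENNReal.ofReal r) :
    P {ω | ¬ (A ω ∧ B ω)} ≤ ENNReal.ofReal (q + r) := by
  rw [ENNReal.ofReal_add hq hr]
  refine (measure_mono fun ω hω => ?_).trans ((measure_union_le _ _).trans (add_le_add hA hB))
  exact not_and_or.1 hω

variable {K M : ℕ} {p : Params M}

lemma Params.card_mul_exp_neg_logPre_le (hdelta : 0 < p.delta) (hM : 0 < M) (l : ℝ) :
    (({l, -l} ×ˢ Finset.univ : Finset (ℝ × Fin M)).card : ℝ) * Real.exp (-p.logPre)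
      ≤ p.delta / 18 := by
  have hcard : (({l, -l} ×ˢ Finset.univ : Finset (ℝ × Fin M)).card : ℝ) ≤ 2 * M := by
    rw [Finset.card_product, Finset.card_univ, Fintype.card_fin]
    push_cast
    gcongr
    exact_mod_cast Finset.card_le_two
  refine (mul_le_mul_of_nonneg_right hcard (Real.exp_pos _).le).trans_eq ?_
  rw [exp_neg_logPre hdelta hM]
  field_simp
  norm_num

lemma card_mul_exp_neg_two_mul_le {n T : ℕ} (hn : 0 < n) (hT : 0 < T) {delta y : ℝ}
    (hdelta : 0 < delta) (hdelta1 : delta < 1) (hy : Real.exp (-y) = delta / (3 * n * T)) :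
    ((Finset.univ ×ˢ Finset.range T : Finset (Fin n × ℕ)).card : ℝ) * Real.exp (-(2 * y))
      ≤ delta / 9 := by
  have hn' : (1 : ℝ) ≤ n := by exact_mod_cast hn
  have hT' : (1 : ℝ) ≤ T := by exact_mod_cast hT
  have hexp : Real.exp (-(2 * y)) = (delta / (3 * n * T)) ^ 2 := by
    rw [← hy, ← Real.exp_nat_mul]
    congr 1
    push_cast
    ring
  rw [Finset.card_product, Finset.card_univ, Fintype.card_fin, Finset.card_range, hexp]
  push_cast
  calc (n : ℝ) * T * (delta / (3 * n * T)) ^ 2 = delta / 9 * (delta / (n * T)) := by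
        field_simp
        norm_num
    _ ≤ delta / 9 := by
        refine mul_le_of_le_one_right (by positivity) ((div_le_one (by positivity)).2 ?_)
        nlinarith

variable {ℱ : Filtration ℕ mΩ} {mu : Fin K → ℝ} {D : Fin M → Measure ℝ}
  {arm : ℕ → Ω → Fin K} {src : ℕ → Ω → Fin M} {X : ℕ → Ω → ℝ} [IsProbabilityMeasure P]

lemma Interaction.measure_not_arm_concentrated_le (h : Interaction P ℱ mu D arm src X)
    (hD : NoiseLaws D p.eta) (heta : 0 < p.eta) (hT : 0 < p.T) (hdelta : 0 < p.delta)
    (hdelta1 : p.delta < 1) (i : Fin K) :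
    P {ω | ¬ ((∀ N ∈ Finset.range p.T, armExponent mu D p.eta (traj arm src X ω) p.prep p.T i N
          (-(p.tilt D K 0.9 N / p.eta)) ≤ p.logArm K) ∧
        ∀ b ∈ (Finset.univ ×ˢ Finset.range p.T : Finset (Fin K × ℕ)),
          armExponent mu D p.eta (traj arm src X ω) p.prep p.T b.1 b.2
            (p.tilt D K 1 b.2 / p.eta) ≤ 2 * p.logArm K)}
      ≤ ENNReal.ofReal (p.delta / 3 + p.delta / 9) := by
  have hexp := Params.exp_neg_logArm hdelta (Fin.pos i) hT
  refine measure_not_and_le (by positivity) (by positivity)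
    (measure_not_forall_le _ (fun N _ => h.measure_lt_armExponent_le hD ?_ _ _ _ _ _) ?_)
    (measure_not_forall_le _ (fun b _ => h.measure_lt_armExponent_le hD ?_ _ _ _ _ _)
      (card_mul_exp_neg_two_mul_le (Fin.pos i) hT hdelta hdelta1 hexp))
  · rw [abs_neg, Params.abs_tilt_div_mul D heta (by norm_num)]
    exact Params.tilt_le_one D _ _
  · have hK : (1 : ℝ) ≤ K := by exact_mod_cast Fin.pos i
    rw [Finset.card_range, hexp,
      show (p.T : ℝ) * (p.delta / (3 * K * p.T)) = p.delta / 3 / K by field_simp]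
    exact div_le_self (by positivity) hK
  · rw [Params.abs_tilt_div_mul D heta (by norm_num)]
    exact Params.tilt_le_one D _ _

lemma Interaction.measure_not_var_concentrated_le (h : Interaction P ℱ mu D arm src X)
    (hD : NoiseLaws D p.eta) (heta : 0 < p.eta) (hT : 0 < p.T) (hdelta : 0 < p.delta)
    (hdelta1 : p.delta < 1) (hM : 0 < M) :
    P {ω | ¬ ((∀ b ∈ (Finset.univ ×ˢ Finset.range p.T : Finset (Fin M × ℕ)),
          lowerVarExponent mu D p.eta (traj arm src X ω) p.prep b.2 b.1 ≤ p.logSrc) ∧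
        ∀ b ∈ (Finset.univ ×ˢ Finset.range p.T : Finset (Fin M × ℕ)),
          upperVarExponent mu D p.eta (traj arm src X ω) p.prep b.2 b.1 ≤ 2 * p.logSrc)}
      ≤ ENNReal.ofReal (p.delta / 3 + p.delta / 9) := by
  have hexp := Params.exp_neg_logSrc hdelta hM hT
  refine measure_not_and_le (by positivity) (by positivity)
    (measure_not_forall_le _ (fun b _ => h.measure_lt_lowerVarExponent_le hD heta _ _ _ _) ?_)
    (measure_not_forall_le _ (fun b _ => h.measure_lt_upperVarExponent_le hD heta _ _ _ _)
      (card_mul_exp_neg_two_mul_le hM hT hdelta hdelta1 hexp))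
  rw [Finset.card_product, Finset.card_univ, Fintype.card_fin, Finset.card_range, hexp]
  push_cast
  refine le_of_eq ?_
  field_simp

theorem Interaction.measure_not_concentrated_le (h : Interaction P ℱ mu D arm src X)
    (hD : NoiseLaws D p.eta) (heta : 0 < p.eta) (hT : 0 < p.T) (hdelta : 0 < p.delta)
    (hdelta1 : p.delta < 1) (hM : 0 < M) (i : Fin K) :
    P {ω | ¬ Concentrated p mu D (traj arm src X ω) i} ≤ ENNReal.ofReal p.delta := by
  have hsq := measure_not_forall_le (P := P) ({2.8, -2.8} ×ˢ Finset.univ : Finset (ℝ × Fin M))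
    (fun b _ => h.measure_lt_sqExponent_le hD 0 p.prep b.2 (b.1 * p.preRate / p.eta ^ 2) p.logPre)
    (Params.card_mul_exp_neg_logPre_le hdelta hM _)
  have hmean := measure_not_forall_le (P := P) ({1.4, -1.4} ×ˢ Finset.univ : Finset (ℝ × Fin M))
    (fun b _ => h.measure_lt_meanExponent_le hD 0 p.prep b.2 (b.1 * p.preRate / p.eta) p.logPre)
    (Params.card_mul_exp_neg_logPre_le hdelta hM _)
  have hall := measure_not_and_le (by positivity) (by positivity)
    (measure_not_and_le (by positivity) (by positivity) hsq hmean)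
    (measure_not_and_le (by positivity) (by positivity)
      (h.measure_not_var_concentrated_le hD heta hT hdelta hdelta1 hM)
      (h.measure_not_arm_concentrated_le hD heta hT hdelta hdelta1 i))
  refine (measure_mono ?_).trans (hall.trans (ENNReal.ofReal_le_ofReal (by linarith)))
  rintro ω hω ⟨⟨hsq, hmean⟩, ⟨hlower, hupper⟩, hbest, harm⟩
  exact hω ⟨fun l hl j => hsq (l, j) (Finset.mk_mem_product hl (Finset.mem_univ j)),
    fun l hl j => hmean (l, j) (Finset.mk_mem_product hl (Finset.mem_univ j)),
    fun j t ht => hlower (j, t) (Finset.mk_mem_product (Finset.mem_univ j) (Finset.mem_range.2 ht)),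
    fun j t ht => hupper (j, t) (Finset.mk_mem_product (Finset.mem_univ j) (Finset.mem_range.2 ht)),
    fun N hN => hbest N (Finset.mem_range.2 hN),
    fun k N hN => harm (k, N) (Finset.mk_mem_product (Finset.mem_univ k) (Finset.mem_range.2 hN))⟩

end UnionBound

lemma one_le_cast_of_fin {n : ℕ} (k : Fin n) : (1 : ℝ) ≤ n := by exact_mod_cast Fin.pos k

/-- A trajectory `x` of SOAR that reaches the adaptive phase, on which all the deviation
inequalities hold and some surviving source has variance at least `c²`. The arm `k` is optimal. -/
structure AdaptiveRun {K M : ℕ} (p : Params M) (mu : Fin K → ℝ) (D : Fin M → Measure ℝ)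
    (x : ℕ → Round K M) (i₀ i₁ k : Fin K) : Prop where
  laws : NoiseLaws D p.eta
  eta_pos : 0 < p.eta
  delta_pos : 0 < p.delta
  delta_lt_one : p.delta < 1
  c_pos : 0 < p.c
  nu_pos : 0 < p.nu
  one_le_tau : 1 ≤ p.tau
  minBudget_le : p.minBudget ≤ p.tau
  isRun : p.IsRun x i₀ i₁
  concentrated : Concentrated p mu D x k
  start₃_lt : p.start₃ x < p.T
  exists_sq_le : ∃ j ∈ p.surviving x, p.c ^ 2 ≤ sd (D j) ^ 2
  le_best : ∀ i, mu i ≤ mu k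

lemma sd_nonneg (ν : Measure ℝ) : 0 ≤ sd ν := Real.sqrt_nonneg _

lemma sdMin_nonneg {M : ℕ} (D : Fin M → Measure ℝ) : 0 ≤ sdMin D :=
  Real.iInf_nonneg fun _ => sd_nonneg _

lemma sdMin_le {M : ℕ} (D : Fin M → Measure ℝ) (j : Fin M) : sdMin D ≤ sd (D j) :=
  ciInf_le (Set.finite_range _).bddBelow j

lemma sdMin_sq_le {M : ℕ} (D : Fin M → Measure ℝ) (j : Fin M) : sdMin D ^ 2 ≤ sd (D j) ^ 2 :=
  pow_le_pow_left₀ (sdMin_nonneg D) (sdMin_le D j) 2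

lemma log_le_div_mul_log {a b : ℕ} (ha : 0 < a) {u v : ℝ} (hu : 0 < u) (huv : u ^ a ≤ v ^ b) :
    Real.log u ≤ b / a * Real.log v := by
  have hlog := Real.log_le_log (pow_pos hu a) huv
  rw [Real.log_pow, Real.log_pow] at hlog
  rw [div_mul_eq_mul_div, le_div_iff₀ (by exact_mod_cast ha)]
  linarith

/-- A bound on the error of the variance estimates of the preprocessing phase. -/
noncomputable def Params.preError {M : ℕ} (p : Params M) : ℝ :=
  p.eta ^ 2 * (0.7072 * p.preRate + 6.01 * p.preRate ^ 2)

lemma Params.preWidth_eq {M : ℕ} (p : Params M) :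
    p.preWidth (p.delta / 3) = 8 * (p.eta ^ 2 * p.preRate) := mul_assoc _ _ _

namespace AdaptiveRun

variable {K M : ℕ} {p : Params M} {mu : Fin K → ℝ} {D : Fin M → Measure ℝ}
  {x : ℕ → Round K M} {i₀ i₁ k : Fin K}

section Preprocessing

lemma one_le_M (h : AdaptiveRun p mu D x i₀ i₁ k) : (1 : ℝ) ≤ M :=
  one_le_cast_of_fin h.exists_sq_le.choose

lemma prep_le (h : AdaptiveRun p mu D x i₀ i₁ k) : p.prep ≤ p.T :=
  (Params.prep_le_start₂.trans Params.start₂_le_start₃).trans h.start₃_lt.le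

lemma one_le_T (h : AdaptiveRun p mu D x i₀ i₁ k) : (1 : ℝ) ≤ p.T := by
  exact_mod_cast (Nat.zero_le _).trans_lt h.start₃_lt

lemma c_sq_le_eta_sq (h : AdaptiveRun p mu D x i₀ i₁ k) : p.c ^ 2 ≤ p.eta ^ 2 := by
  obtain ⟨j, -, hj⟩ := h.exists_sq_le
  exact hj.trans (pow_le_pow_left₀ (sd_nonneg _) (h.laws.centeredLaw j).sd_le 2)

lemma tau_pos (h : AdaptiveRun p mu D x i₀ i₁ k) : (0 : ℝ) < p.tau := by
  exact_mod_cast h.one_le_tau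

lemma logPre_pos (h : AdaptiveRun p mu D x i₀ i₁ k) : 0 < p.logPre := by
  have hM := h.one_le_M
  have hdelta := h.delta_pos
  have hdelta₁ := h.delta_lt_one
  refine Real.log_pos ?_
  rw [lt_div_iff₀ (by positivity)]
  linarith

lemma preRate_pos (h : AdaptiveRun p mu D x i₀ i₁ k) : 0 < p.preRate :=
  Real.sqrt_pos.2 (div_pos h.logPre_pos h.tau_pos)

lemma tau_mul_preRate_sq (h : AdaptiveRun p mu D x i₀ i₁ k) :
    p.tau * p.preRate ^ 2 = p.logPre := by
  rw [Params.preRate, Real.sq_sqrt (div_pos h.logPre_pos h.tau_pos).le,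
    mul_div_cancel₀ _ h.tau_pos.ne']

lemma card_srcRounds_prep (h : AdaptiveRun p mu D x i₀ i₁ k) (j : Fin M) :
    (srcRounds x 0 p.prep j).card = p.tau :=
  h.isRun.card_srcRounds_prep h.prep_le h.one_le_tau j

lemma abs_sum_resid_sq_sub_le (h : AdaptiveRun p mu D x i₀ i₁ k) (j : Fin M) :
    |∑ s ∈ srcRounds x 0 p.prep j, resid mu x s ^ 2 - p.tau * sd (D j) ^ 2|
      ≤ p.tau * (p.eta ^ 2 * (0.7072 * p.preRate)) := by
  have hrate := h.preRate_pos
  have heta := h.eta_pos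
  have htau := h.tau_pos
  set S := ∑ s ∈ srcRounds x 0 p.prep j, resid mu x s ^ 2 - p.tau * sd (D j) ^ 2 with hS
  have tilted : ∀ l : ℝ, l ∈ ({2.8, -2.8} : Finset ℝ) →
      l * S ≤ p.tau * (p.eta ^ 2 * ((1 + l ^ 2 / 8) * p.preRate)) := by
    intro l hl
    have hexp := h.concentrated.pre_sq l hl j
    rw [sqExponent, Finset.sum_sub_distrib, ← Finset.mul_sum, Finset.sum_sub_distrib,
      Finset.sum_const, Finset.sum_const, h.card_srcRounds_prep, nsmul_eq_mul, nsmul_eq_mul,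
      ← h.tau_mul_preRate_sq, ← hS] at hexp
    refine le_of_mul_le_mul_right ?_ (show 0 < p.preRate / p.eta ^ 2 by positivity)
    calc l * S * (p.preRate / p.eta ^ 2) = l * p.preRate / p.eta ^ 2 * S := by ring
      _ ≤ p.tau * p.preRate ^ 2
          + p.tau * ((l * p.preRate / p.eta ^ 2) ^ 2 * (p.eta ^ 2) ^ 2 / 8) := by linarith
      _ = _ := by field_simp
  have hupper := tilted 2.8 (by simp)
  have hlower := tilted (-2.8) (by simp)
  rw [abs_le]
  constructor <;> linarith

lemma abs_sum_resid_le (h : AdaptiveRun p mu D x i₀ i₁ k) (j : Fin M) :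
    |∑ s ∈ srcRounds x 0 p.prep j, resid mu x s| ≤ p.tau * (p.eta * (1.415 * p.preRate)) := by
  have hrate := h.preRate_pos
  have heta := h.eta_pos
  have htau := h.tau_pos
  set S := ∑ s ∈ srcRounds x 0 p.prep j, resid mu x s with hS
  have tilted : ∀ l : ℝ, l ∈ ({1.4, -1.4} : Finset ℝ) →
      l * S ≤ p.tau * (p.eta * ((1 + l ^ 2 / 2) * p.preRate)) := by
    intro l hl
    have hexp := h.concentrated.pre_mean l hl j
    rw [meanExponent, Finset.sum_sub_distrib, ← Finset.mul_sum, Finset.sum_const,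
      h.card_srcRounds_prep, nsmul_eq_mul, ← h.tau_mul_preRate_sq, ← hS] at hexp
    refine le_of_mul_le_mul_right ?_ (show 0 < p.preRate / p.eta by positivity)
    calc l * S * (p.preRate / p.eta) = l * p.preRate / p.eta * S := by ring
      _ ≤ p.tau * p.preRate ^ 2
          + p.tau * ((l * p.preRate / p.eta) ^ 2 * (2 * p.eta) ^ 2 / 8) := by linarith
      _ = _ := by field_simp; ring
  have hupper := tilted 1.4 (by simp)
  have hlower := tilted (-1.4) (by simp)
  rw [abs_le]
  constructor <;> linarith

lemma abs_avg_resid_le (h : AdaptiveRun p mu D x i₀ i₁ k) :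
    |avg (resid mu x) (Finset.range p.prep)| ≤ p.eta * (1.415 * p.preRate) := by
  have htau := h.tau_pos
  have hM := h.one_le_M
  have hprep : (p.prep : ℝ) = M * p.tau := Nat.cast_mul M p.tau
  have hsum : ∑ s ∈ Finset.range p.prep, resid mu x s
      = ∑ j, ∑ s ∈ srcRounds x 0 p.prep j, resid mu x s := by
    simp_rw [srcRounds, ← Finset.range_eq_Ico, Finset.sum_fiberwise]
  rw [avg, hsum, Finset.card_range, abs_div, hprep,
    abs_of_pos (by positivity : 0 < (M : ℝ) * p.tau),
    div_le_iff₀ (by positivity)]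
  calc |∑ j, ∑ s ∈ srcRounds x 0 p.prep j, resid mu x s|
      ≤ ∑ j : Fin M, |∑ s ∈ srcRounds x 0 p.prep j, resid mu x s| :=
        Finset.abs_sum_le_sum_abs _ _
    _ ≤ ∑ _j : Fin M, p.tau * (p.eta * (1.415 * p.preRate)) :=
        Finset.sum_le_sum fun j _ => h.abs_sum_resid_le j
    _ = _ := by rw [Finset.sum_const, Finset.card_univ, Fintype.card_fin, nsmul_eq_mul]; ring

lemma tau_mul_preVar (h : AdaptiveRun p mu D x i₀ i₁ k) (j : Fin M) :
    p.tau * p.preVar x j = ∑ s ∈ srcRounds x 0 p.prep j, resid mu x s ^ 2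
      - 2 * (avg (resid mu x) (Finset.range p.prep)
        * ∑ s ∈ srcRounds x 0 p.prep j, resid mu x s)
      + p.tau * avg (resid mu x) (Finset.range p.prep) ^ 2 := by
  have hM : 0 < M := by exact_mod_cast h.one_le_M
  have hprep := h.isRun.armRounds_prep h.prep_le
  have hne : (armRounds x 0 p.prep i₀).Nonempty := by
    rw [hprep, Finset.nonempty_range_iff]
    exact (Nat.mul_pos hM h.one_le_tau).ne'
  rw [Params.preVar, h.card_srcRounds_prep, mul_div_cancel₀ _ h.tau_pos.ne', Finset.mul_sum,
    Finset.mul_sum, ← Finset.sum_sub_distrib, ← h.card_srcRounds_prep j, ← nsmul_eq_mul,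
    ← Finset.sum_const, ← Finset.sum_add_distrib]
  refine Finset.sum_congr rfl fun s hs => ?_
  have hs := (Finset.mem_Ico.1 (Finset.mem_filter.1 hs).1).2
  have harm := (h.isRun.preprocess s (hs.trans_le h.prep_le) hs).1
  rw [harm, armMean_eq mu x 0 p.prep i₀ hne, hprep, resid, harm]
  ring

theorem abs_preVar_sub_le (h : AdaptiveRun p mu D x i₀ i₁ k) (j : Fin M) :
    |p.preVar x j - sd (D j) ^ 2| ≤ p.preError := by
  have htau := h.tau_pos
  have hvar := h.tau_mul_preVar j
  have hsq := abs_le.1 (h.abs_sum_resid_sq_sub_le j)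
  set m := avg (resid mu x) (Finset.range p.prep)
  set S := ∑ s ∈ srcRounds x 0 p.prep j, resid mu x s
  have hcross : |m * S| ≤ p.tau * (p.eta * (1.415 * p.preRate)) ^ 2 := by
    rw [abs_mul]
    calc |m| * |S| ≤ (p.eta * (1.415 * p.preRate)) * (p.tau * (p.eta * (1.415 * p.preRate))) :=
          mul_le_mul h.abs_avg_resid_le (h.abs_sum_resid_le j) (abs_nonneg _)
            ((abs_nonneg _).trans h.abs_avg_resid_le)
      _ = _ := by ring
  have hmean : p.tau * m ^ 2 ≤ p.tau * (p.eta * (1.415 * p.preRate)) ^ 2 := by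
    rw [← sq_abs m]
    gcongr
    exact h.abs_avg_resid_le
  have hmean₀ : 0 ≤ p.tau * m ^ 2 := by positivity
  have hcross := abs_le.1 hcross
  refine le_of_mul_le_mul_left ?_ htau
  rw [← abs_of_pos htau, ← abs_mul, mul_sub, hvar, abs_of_pos htau, Params.preError, abs_le]
  constructor <;> linarith

lemma logPre_le (h : AdaptiveRun p mu D x i₀ i₁ k) {n : ℕ} (hn : 0 < n) (hnM : n ≤ M) {q : ℝ}
    (hq : 0 ≤ q) (hlog : Real.log 3 ≤ q * Real.log (12 * n)) :
    p.logPre ≤ (1 + q) * Real.log (12 * M / p.delta) := by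
  have hdelta := h.delta_pos
  have hM := h.one_le_M
  have hnM : (n : ℝ) ≤ M := by exact_mod_cast hnM
  have hsplit : p.logPre = Real.log 3 + Real.log (12 * M / p.delta) := by
    rw [Params.logPre, ← Real.log_mul (by norm_num) (by positivity)]
    congr 1
    field_simp
  have hmono : Real.log (12 * n) ≤ Real.log (12 * M / p.delta) := by
    refine Real.log_le_log (by positivity) ?_
    rw [le_div_iff₀ hdelta]
    nlinarith [h.delta_lt_one]
  rw [hsplit]
  linarith [mul_le_mul_of_nonneg_left hmono hq]

lemma preRate_sq_le (h : AdaptiveRun p mu D x i₀ i₁ k) {q : ℝ} (hq : 0 ≤ q)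
    (hlog : p.logPre ≤ q * Real.log (12 * M / p.delta)) :
    1024 * (p.eta ^ 2 * p.preRate) ^ 2 ≤ q * (p.c ^ 2) ^ 2 := by
  have hbudget := h.minBudget_le
  have hc := h.c_pos
  rw [Params.minBudget, div_le_iff₀ (by positivity)] at hbudget
  refine le_of_mul_le_mul_left ?_ h.tau_pos
  calc p.tau * (1024 * (p.eta ^ 2 * p.preRate) ^ 2)
      = 1024 * p.eta ^ 4 * (p.tau * p.preRate ^ 2) := by ring
    _ ≤ 1024 * p.eta ^ 4 * (q * Real.log (12 * M / p.delta)) := by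
        rw [h.tau_mul_preRate_sq]
        gcongr
    _ = q * (1024 * p.eta ^ 4 * Real.log (12 * M / p.delta)) := by ring
    _ ≤ q * (p.tau * p.c ^ 4) := by gcongr
    _ = _ := by ring

lemma preRate_le (h : AdaptiveRun p mu D x i₀ i₁ k) :
    p.eta ^ 2 * p.preRate ≤ 0.0376 * p.c ^ 2 := by
  have hlog : Real.log 3 ≤ (4 : ℕ) / (9 : ℕ) * Real.log (12 * (1 : ℕ)) :=
    log_le_div_mul_log (by norm_num) (by norm_num) (by norm_num)
  have hM : 1 ≤ M := by exact_mod_cast h.one_le_M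
  have hsq := h.preRate_sq_le (by norm_num) (h.logPre_le one_pos hM (by norm_num) hlog)
  refine abs_le_of_sq_le_sq' ?_ (by positivity) |>.2
  norm_num at hsq
  nlinarith [sq_nonneg (p.c ^ 2)]

lemma preRate_le_of_two_le (h : AdaptiveRun p mu D x i₀ i₁ k) (hM : 2 ≤ M) :
    p.eta ^ 2 * p.preRate ≤ 0.03626 * p.c ^ 2 := by
  have hlog : Real.log 3 ≤ (9 : ℕ) / (26 : ℕ) * Real.log (12 * (2 : ℕ)) :=
    log_le_div_mul_log (by norm_num) (by norm_num) (by norm_num)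
  have hsq := h.preRate_sq_le (by norm_num) (h.logPre_le two_pos hM (by norm_num) hlog)
  refine abs_le_of_sq_le_sq' ?_ (by positivity) |>.2
  norm_num at hsq
  nlinarith [sq_nonneg (p.c ^ 2)]

lemma preError_le (h : AdaptiveRun p mu D x i₀ i₁ k) {q : ℝ} (hq : 0 ≤ q)
    (hrate : p.eta ^ 2 * p.preRate ≤ q * p.c ^ 2) :
    p.preError ≤ (0.7072 * q + 6.01 * q ^ 2) * p.c ^ 2 := by
  have hpos := h.preRate_pos
  have hle : p.preRate ≤ q := by
    refine le_of_mul_le_mul_left (hrate.trans ?_) (pow_pos h.eta_pos 2)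
    rw [mul_comm]
    exact mul_le_mul_of_nonneg_right h.c_sq_le_eta_sq hq
  calc p.preError = (0.7072 + 6.01 * p.preRate) * (p.eta ^ 2 * p.preRate) := by
        rw [Params.preError]
        ring
    _ ≤ (0.7072 + 6.01 * q) * (q * p.c ^ 2) := by gcongr
    _ = _ := by ring

lemma exists_sd_eq_sdMin (h : AdaptiveRun p mu D x i₀ i₁ k) : ∃ j, sd (D j) = sdMin D :=
  have : Nonempty (Fin M) := ⟨h.exists_sq_le.choose⟩
  exists_eq_ciInf_of_finite

lemma sd_sq_le_add_preError (h : AdaptiveRun p mu D x i₀ i₁ k) {j : Fin M}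
    (hj : j ∈ p.surviving x) :
    sd (D j) ^ 2 ≤ sdMin D ^ 2 + 2 * (8 * (p.eta ^ 2 * p.preRate)) + 2 * p.preError := by
  obtain ⟨l, hl⟩ := h.exists_sd_eq_sdMin
  have hLCB := (le_max_left _ _).trans ((Finset.mem_filter.1 hj).2 l)
  rw [Params.preUCB, p.preWidth_eq] at hLCB
  rw [← hl]
  linarith [(abs_le.1 (h.abs_preVar_sub_le j)).1, (abs_le.1 (h.abs_preVar_sub_le l)).2]

theorem sd_sq_le (h : AdaptiveRun p mu D x i₀ i₁ k) {j : Fin M} (hj : j ∈ p.surviving x) :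
    sd (D j) ^ 2 ≤ sdMin D ^ 2 + 0.65 * p.c ^ 2 := by
  rcases Nat.lt_or_ge M 2 with hM | hM
  · obtain ⟨l, hl⟩ := h.exists_sd_eq_sdMin
    have : j = l := by ext; omega
    rw [← hl, ← this]
    nlinarith
  · have hrate := h.preRate_le_of_two_le hM
    nlinarith [h.sd_sq_le_add_preError hj, h.preError_le (by norm_num) hrate]

lemma le_sdMin_sq (h : AdaptiveRun p mu D x i₀ i₁ k) : 0.35 * p.c ^ 2 ≤ sdMin D ^ 2 := by
  obtain ⟨j, hj, hc⟩ := h.exists_sq_le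
  linarith [h.sd_sq_le hj]

lemma sd_sq_le_mul_sdMin_sq (h : AdaptiveRun p mu D x i₀ i₁ k) {j : Fin M}
    (hj : j ∈ p.surviving x) : sd (D j) ^ 2 ≤ 20 / 7 * sdMin D ^ 2 := by
  linarith [h.sd_sq_le hj, h.le_sdMin_sq]

lemma le_sd_sq_of_le_preLCB (h : AdaptiveRun p mu D x i₀ i₁ k) {j : Fin M}
    (hj : p.c ^ 2 / 2 ≤ p.preLCB x (p.delta / 3) j) : 0.6 * p.c ^ 2 ≤ sd (D j) ^ 2 := by
  have hc := h.c_pos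
  obtain ⟨l, hlS, hlc⟩ := h.exists_sq_le
  have hpre : p.c ^ 2 / 2 ≤ p.preVar x j - 8 * (p.eta ^ 2 * p.preRate) := by
    rw [← p.preWidth_eq]
    exact (le_max_iff.1 hj).resolve_right (by nlinarith)
  nlinarith [h.sd_sq_le_add_preError hlS, sdMin_sq_le D j, abs_le.1 (h.abs_preVar_sub_le j),
    h.preError_le (by norm_num) h.preRate_le]

theorem exists_explored_source (h : AdaptiveRun p mu D x i₀ i₁ k) :
    ∃ j ∈ p.surviving x, 0.6 * p.c ^ 2 ≤ sd (D j) ^ 2 ∧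
      ∀ t, p.start₂ K ≤ t → ∀ i, p.alpha K ≤ (pairRounds x p.prep t i j).card := by
  obtain ⟨j, hj, hpreLCB, hcard⟩ := h.isRun.exists_alpha_le_card
  refine ⟨j, hj, h.le_sd_sq_of_le_preLCB (hpreLCB ?_),
    fun t ht => hcard t ht (Params.start₂_le_start₃.trans h.start₃_lt.le)⟩
  obtain ⟨l, hlS, hlc⟩ := h.exists_sq_le
  refine ⟨l, hlS, le_trans ?_ (le_max_left _ _)⟩
  rw [p.preWidth_eq]
  nlinarith [abs_le.1 (h.abs_preVar_sub_le l), h.preError_le (by norm_num) h.preRate_le,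
    h.preRate_le]

end Preprocessing

end AdaptiveRun

section Estimates

variable {K M : ℕ} (p : Params M) (D : Fin M → Measure ℝ) (x : ℕ → Round K M)

/-- The part of `beta` that makes the variance estimates accurate. -/
noncomputable def Params.varBudget : ℝ := 16 * p.eta ^ 4 * p.logSrc / p.c ^ 4

/-- The sum of the noise variances over the pulls of arm `i` before round `t`. -/
noncomputable def Params.armVar (t : ℕ) (i : Fin K) : ℝ :=
  ∑ s ∈ armRounds x p.prep t i, sd (D (x s).2.1) ^ 2

/-- The estimate of `armVar` that enters the upper confidence bound of arm `i`. -/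
noncomputable def Params.armVarEst (t : ℕ) (i : Fin K) : ℝ :=
  ∑ j, ((pairRounds x p.prep t i j).card : ℝ) * pooledVar x p.prep t j

variable {p x}

lemma Params.armVar_eq_sum_pairRounds (t : ℕ) (i : Fin K) :
    p.armVar D x t i = ∑ j, ((pairRounds x p.prep t i j).card : ℝ) * sd (D j) ^ 2 :=
  (sum_card_pairRounds_mul x p.prep t i fun j => sd (D j) ^ 2).symm

lemma Params.armVar_nonneg (t : ℕ) (i : Fin K) : 0 ≤ p.armVar D x t i :=
  Finset.sum_nonneg fun _ _ => sq_nonneg _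

lemma Params.le_armVar (t : ℕ) (i : Fin K) :
    (armRounds x p.prep t i).card * sdMin D ^ 2 ≤ p.armVar D x t i := by
  rw [Params.armVar, ← nsmul_eq_mul]
  exact Finset.card_nsmul_le_sum _ _ _ fun s _ => sdMin_sq_le D _

lemma card_pairRounds_le (a t : ℕ) (i : Fin K) (j : Fin M) :
    (pairRounds x a t i j).card ≤ (armRounds x a t i).card :=
  Finset.card_le_card (Finset.monotone_filter_right _ fun _ _ hs => hs.1)

lemma card_armRounds_lt (a : ℕ) {t T : ℕ} (htT : t < T) (i : Fin K) :
    (armRounds x a t i).card < T :=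
  ((Finset.card_filter_le _ _).trans (Nat.card_Ico a t).le).trans_lt (by omega)

lemma firstPulls_card_armRounds (a : ℕ) {t T : ℕ} (htT : t ≤ T) (i : Fin K) :
    firstPulls x a T i (armRounds x a t i).card = armRounds x a t i :=
  filter_range_card_hits_lt (p := fun s => (x s).1 = i) htT

end Estimates

lemma exp_eight_le : Real.exp 8 ≤ 3072 := by
  rw [show (8 : ℝ) = ((8 : ℕ) : ℝ) * 1 by norm_num, Real.exp_nat_mul]
  calc Real.exp 1 ^ 8 ≤ 2.7182818286 ^ 8 :=
        pow_le_pow_left₀ (Real.exp_pos 1).le Real.exp_one_lt_d9.le 8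
    _ ≤ 3072 := by norm_num

namespace AdaptiveRun

variable {K M : ℕ} {p : Params M} {mu : Fin K → ℝ} {D : Fin M → Measure ℝ}
  {x : ℕ → Round K M} {i₀ i₁ k : Fin K}

section SampleSizes

lemma c_pow_four_le (h : AdaptiveRun p mu D x i₀ i₁ k) : p.c ^ 4 ≤ p.eta ^ 4 := by
  simpa only [← pow_mul] using pow_le_pow_left₀ (sq_nonneg p.c) h.c_sq_le_eta_sq 2

lemma le_tau (h : AdaptiveRun p mu D x i₀ i₁ k) : (1024 : ℝ) ≤ p.tau := by
  have hdelta := h.delta_pos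
  have hc := h.c_pos
  have heta := h.eta_pos
  have hM := h.one_le_M
  have hlog : 1 ≤ Real.log (12 * M / p.delta) := by
    rw [Real.le_log_iff_exp_le (by positivity), le_div_iff₀ hdelta]
    nlinarith [Real.exp_one_lt_d9, Real.exp_pos 1, h.delta_lt_one]
  have hbudget := h.minBudget_le
  rw [Params.minBudget, div_le_iff₀ (by positivity)] at hbudget
  refine le_of_mul_le_mul_right (le_trans ?_ hbudget) (pow_pos hc 4)
  calc 1024 * p.c ^ 4 ≤ 1024 * p.eta ^ 4 * 1 := by linarith [h.c_pow_four_le]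
    _ ≤ 1024 * p.eta ^ 4 * Real.log (12 * M / p.delta) := by gcongr

lemma le_logSrc (h : AdaptiveRun p mu D x i₀ i₁ k) : 8 ≤ p.logSrc := by
  have hM := h.one_le_M
  have hdelta := h.delta_pos
  have hT₁ := h.one_le_T
  have hT : (1024 : ℝ) ≤ p.T := by
    have hprep : (p.prep : ℝ) ≤ p.T := by exact_mod_cast h.prep_le
    rw [Params.prep, Nat.cast_mul] at hprep
    nlinarith [h.le_tau]
  rw [Params.logSrc, Real.le_log_iff_exp_le (by positivity), le_div_iff₀ hdelta]
  calc Real.exp 8 * p.delta ≤ 3072 * 1 := by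
        gcongr
        exacts [exp_eight_le, h.delta_lt_one.le]
    _ ≤ 3 * 1 * 1024 := by norm_num
    _ ≤ 3 * M * p.T := by gcongr

lemma logArm_pos (h : AdaptiveRun p mu D x i₀ i₁ k) : 0 < p.logArm K := by
  have hK := one_le_cast_of_fin k
  have hT := h.one_le_T
  have hdelta := h.delta_pos
  refine Real.log_pos ?_
  rw [lt_div_iff₀ hdelta]
  nlinarith [h.delta_lt_one]

lemma le_varBudget (h : AdaptiveRun p mu D x i₀ i₁ k) : 128 ≤ p.varBudget := by
  have hc := h.c_pos
  rw [Params.varBudget, le_div_iff₀ (by positivity)]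
  calc 128 * p.c ^ 4 = 16 * p.c ^ 4 * 8 := by ring
    _ ≤ 16 * p.eta ^ 4 * p.logSrc :=
        mul_le_mul (by linarith [h.c_pow_four_le]) h.le_logSrc (by norm_num) (by positivity)

lemma eta_sq_mul_logSrc_le (h : AdaptiveRun p mu D x i₀ i₁ k) :
    p.eta ^ 2 * p.logSrc ≤ p.varBudget * p.c ^ 2 / 16 := by
  have hc := h.c_pos
  have hlog : 0 ≤ p.logSrc := by linarith [h.le_logSrc]
  rw [Params.varBudget, le_div_iff₀ (by norm_num), div_mul_eq_mul_div, le_div_iff₀ (by positivity)]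
  calc p.eta ^ 2 * p.logSrc * 16 * p.c ^ 4
      = 16 * (p.eta ^ 2 * p.logSrc * p.c ^ 2) * p.c ^ 2 := by ring
    _ ≤ 16 * (p.eta ^ 2 * p.logSrc * p.c ^ 2) * p.eta ^ 2 :=
        mul_le_mul_of_nonneg_left h.c_sq_le_eta_sq (by positivity)
    _ = 16 * p.eta ^ 4 * p.logSrc * p.c ^ 2 := by ring

lemma le_card_pairRounds (h : AdaptiveRun p mu D x i₀ i₁ k) {t : ℕ} (ht : p.start₃ x ≤ t)
    {j : Fin M} (hj : j ∈ p.surviving x) :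
    2 * K + p.varBudget ≤ ((pairRounds x p.prep t i₁ j).card : ℝ) := by
  have hbeta : (p.beta K : ℝ) ≤ ((pairRounds x p.prep t i₁ j).card : ℝ) := by
    exact_mod_cast h.isRun.beta_le_card ht h.start₃_lt.le hj
  refine le_trans ?_ ((Nat.le_ceil _).trans hbeta)
  have hlog : 0 ≤ p.logSrc := by linarith [h.le_logSrc]
  have hnu : 0 ≤ 4 * p.eta ^ 4 * p.logSrc / p.nu :=
    div_nonneg (by positivity) h.nu_pos.le
  rw [Params.varBudget]
  linarith

lemma le_card_srcRounds (h : AdaptiveRun p mu D x i₀ i₁ k) {t : ℕ} (ht : p.start₃ x ≤ t)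
    {j : Fin M} (hj : j ∈ p.surviving x) :
    2 * K + p.varBudget ≤ ((srcRounds x p.prep t j).card : ℝ) := by
  refine (h.le_card_pairRounds ht hj).trans ?_
  rw [← sum_card_pairRounds]
  exact Finset.single_le_sum (f := fun i => ((pairRounds x p.prep t i j).card : ℝ))
    (fun _ _ => Nat.cast_nonneg _) (Finset.mem_univ i₁)

lemma varBudget_le_dof (h : AdaptiveRun p mu D x i₀ i₁ k) {t : ℕ} (ht : p.start₃ x ≤ t)
    {j : Fin M} (hj : j ∈ p.surviving x) :
    K + p.varBudget ≤ ((srcRounds x p.prep t j).card : ℝ) - K := by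
  linarith [h.le_card_srcRounds ht hj]

lemma dof_pos (h : AdaptiveRun p mu D x i₀ i₁ k) {t : ℕ} (ht : p.start₃ x ≤ t)
    {j : Fin M} (hj : j ∈ p.surviving x) :
    0 < ((srcRounds x p.prep t j).card : ℝ) - K := by
  linarith [h.varBudget_le_dof ht hj, h.le_varBudget, one_le_cast_of_fin k]

lemma exists_le_card_pairRounds (h : AdaptiveRun p mu D x i₀ i₁ k) :
    ∃ j ∈ p.surviving x, 0.6 * p.c ^ 2 ≤ sd (D j) ^ 2 ∧ ∀ t, p.start₃ x ≤ t → ∀ i,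
      p.eta ^ 2 * p.logArm K ≤ ((pairRounds x p.prep t i j).card : ℝ) * p.c ^ 2 := by
  obtain ⟨j, hj, hsd, halpha⟩ := h.exists_explored_source
  refine ⟨j, hj, hsd, fun t ht i => ?_⟩
  have hcard : (p.alpha K : ℝ) ≤ ((pairRounds x p.prep t i j).card : ℝ) := by
    exact_mod_cast halpha t (Params.start₂_le_start₃.trans ht) i
  exact (div_le_iff₀ (pow_pos h.c_pos 2)).1 ((Nat.le_ceil _).trans hcard)

lemma le_card_armRounds (h : AdaptiveRun p mu D x i₀ i₁ k) {t : ℕ} (ht : p.start₃ x ≤ t)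
    (i : Fin K) : p.eta ^ 2 * p.logArm K ≤ ((armRounds x p.prep t i).card : ℝ) * p.c ^ 2 := by
  obtain ⟨j, -, -, hpair⟩ := h.exists_le_card_pairRounds
  refine (hpair t ht i).trans (mul_le_mul_of_nonneg_right ?_ (sq_nonneg p.c))
  exact_mod_cast card_pairRounds_le p.prep t i j

lemma card_armRounds_pos (h : AdaptiveRun p mu D x i₀ i₁ k) {t : ℕ} (ht : p.start₃ x ≤ t)
    (i : Fin K) : 0 < (armRounds x p.prep t i).card := by
  have hpos := (mul_pos (pow_pos h.eta_pos 2) h.logArm_pos).trans_le (h.le_card_armRounds ht i)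
  exact_mod_cast pos_of_mul_pos_left hpos (sq_nonneg p.c)

lemma src_mem_surviving (h : AdaptiveRun p mu D x i₀ i₁ k) {t s : ℕ} (htT : t < p.T) {i : Fin K}
    (hs : s ∈ armRounds x p.prep t i) : (x s).2.1 ∈ p.surviving x := by
  have hs := Finset.mem_Ico.1 (Finset.mem_filter.1 hs).1
  exact h.isRun.src_mem hs.1 (hs.2.trans htT)

lemma mem_surviving_of_card_ne_zero (h : AdaptiveRun p mu D x i₀ i₁ k) {t : ℕ} (htT : t < p.T)
    {i : Fin K} {j : Fin M} (hcard : (pairRounds x p.prep t i j).card ≠ 0) :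
    j ∈ p.surviving x := by
  obtain ⟨s, hs⟩ := Finset.card_ne_zero.1 hcard
  obtain ⟨hst, harm, rfl⟩ := Finset.mem_filter.1 hs
  exact h.src_mem_surviving htT (Finset.mem_filter.2 ⟨hst, harm⟩)

end SampleSizes

section VarianceEstimates

lemma le_pooledSq (h : AdaptiveRun p mu D x i₀ i₁ k) {t : ℕ} (ht : p.start₃ x ≤ t)
    (htT : t < p.T) {j : Fin M} (hj : j ∈ p.surviving x) :
    0.5 * sd (D j) ^ 2 * (((srcRounds x p.prep t j).card : ℝ) - K)
      + (0.2235 * sd (D j) ^ 2 - p.c ^ 2 / 8) * p.varBudget ≤ pooledSq x p.prep t j := by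
  have heta := h.eta_pos
  have hexp := h.concentrated.var_lower j t htT
  have hexponent : lowerVarExponent mu D p.eta x p.prep t j
      = (3 / 8 * sd (D j) ^ 2 * ∑ s ∈ srcRounds x p.prep t j, weight x p.prep s
        - pooledSq x p.prep t j / 2) / p.eta ^ 2 := by
    rw [lowerVarExponent, pooledSq_eq_sum_weight mu, Finset.sum_sub_distrib, ← Finset.sum_div,
      ← Finset.sum_div, ← Finset.sum_mul, ← Finset.mul_sum]
    field_simp
  rw [hexponent, div_le_iff₀ (by positivity)] at hexp
  have hweight := mul_le_mul_of_nonneg_left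
    (le_sum_weight x p.prep t j i₁ h.le_varBudget (h.le_card_pairRounds ht hj))
    (sq_nonneg (sd (D j)))
  linarith [h.eta_sq_mul_logSrc_le]

lemma half_sd_sq_le_pooledVar (h : AdaptiveRun p mu D x i₀ i₁ k) {t : ℕ}
    (ht : p.start₃ x ≤ t) (htT : t < p.T) {j : Fin M} (hj : j ∈ p.surviving x)
    (hsd : 0.6 * p.c ^ 2 ≤ sd (D j) ^ 2) : 0.5 * sd (D j) ^ 2 ≤ pooledVar x p.prep t j := by
  refine (le_div_iff₀ (h.dof_pos ht hj)).2 (le_trans ?_ (h.le_pooledSq ht htT hj))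
  have hc := sq_nonneg p.c
  have : 0 ≤ (0.2235 * sd (D j) ^ 2 - p.c ^ 2 / 8) * p.varBudget :=
    mul_nonneg (by linarith) (by linarith [h.le_varBudget])
  linarith

lemma sd_sq_le_pooledVar (h : AdaptiveRun p mu D x i₀ i₁ k) {t : ℕ} (ht : p.start₃ x ≤ t)
    (htT : t < p.T) {j : Fin M} (hj : j ∈ p.surviving x) :
    0.36 * sd (D j) ^ 2 ≤ pooledVar x p.prep t j := by
  refine (le_div_iff₀ (h.dof_pos ht hj)).2 (le_trans ?_ (h.le_pooledSq ht htT hj))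
  have hsd := h.le_sdMin_sq.trans (sdMin_sq_le D j)
  have hbudget : (-0.14 * sd (D j) ^ 2) * p.varBudget
      ≤ (0.2235 * sd (D j) ^ 2 - p.c ^ 2 / 8) * p.varBudget :=
    mul_le_mul_of_nonneg_right (by linarith [sq_nonneg p.c]) (by linarith [h.le_varBudget])
  have hdof : sd (D j) ^ 2 * p.varBudget
      ≤ sd (D j) ^ 2 * (((srcRounds x p.prep t j).card : ℝ) - K) := by
    gcongr
    linarith [h.varBudget_le_dof ht hj, one_le_cast_of_fin k]
  linarith

lemma pooledSq_le (h : AdaptiveRun p mu D x i₀ i₁ k) {t : ℕ} (htT : t < p.T) (j : Fin M) :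
    pooledSq x p.prep t j
      ≤ 2 * (srcRounds x p.prep t j).card * sd (D j) ^ 2 + 2 * (p.eta ^ 2 * p.logSrc) := by
  have heta := h.eta_pos
  refine (pooledSq_le_sum_sq mu x p.prep t j).trans ?_
  have hexp := h.concentrated.var_upper j t htT
  rw [upperVarExponent, Finset.sum_sub_distrib, ← Finset.sum_div, Finset.sum_const,
    nsmul_eq_mul] at hexp
  set S := ∑ s ∈ srcRounds x p.prep t j, resid mu x s ^ 2
  set m := ((srcRounds x p.prep t j).card : ℝ)
  rw [show S / p.eta ^ 2 - m * (2 / p.eta ^ 2 * sd (D j) ^ 2)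
      = (S - 2 * m * sd (D j) ^ 2) / p.eta ^ 2 by ring, div_le_iff₀ (by positivity)] at hexp
  linarith

lemma pooledVar_le_sd_sq (h : AdaptiveRun p mu D x i₀ i₁ k) {t : ℕ} (ht : p.start₃ x ≤ t)
    (htT : t < p.T) {j : Fin M} (hj : j ∈ p.surviving x) :
    pooledVar x p.prep t j ≤ 5 * sd (D j) ^ 2 := by
  refine (div_le_iff₀ (h.dof_pos ht hj)).2 ((h.pooledSq_le htT j).trans ?_)
  have hsd := h.le_sdMin_sq.trans (sdMin_sq_le D j)
  have hdof := h.varBudget_le_dof ht hj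
  have hbudget := h.le_varBudget
  have hK := one_le_cast_of_fin k
  set m := ((srcRounds x p.prep t j).card : ℝ)
  have hc : p.varBudget * p.c ^ 2 ≤ (m - K) * (20 / 7 * sd (D j) ^ 2) :=
    mul_le_mul (by linarith) (by linarith) (sq_nonneg _) (by linarith)
  have hm : m * sd (D j) ^ 2 ≤ 2 * (m - K) * sd (D j) ^ 2 := by
    gcongr
    linarith
  have hpos : 0 ≤ (m - K) * sd (D j) ^ 2 := mul_nonneg (by linarith) (sq_nonneg _)
  linarith [h.eta_sq_mul_logSrc_le]

lemma armVar_le (h : AdaptiveRun p mu D x i₀ i₁ k) {t : ℕ} (htT : t < p.T) (i : Fin K) :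
    p.armVar D x t i ≤ (armRounds x p.prep t i).card * (20 / 7 * sdMin D ^ 2) := by
  rw [Params.armVar, ← nsmul_eq_mul]
  exact Finset.sum_le_card_nsmul _ _ _ fun s hs =>
    h.sd_sq_le_mul_sdMin_sq (h.src_mem_surviving htT hs)

lemma armVarEst_le (h : AdaptiveRun p mu D x i₀ i₁ k) {t : ℕ} (ht : p.start₃ x ≤ t)
    (htT : t < p.T) (i : Fin K) : p.armVarEst x t i ≤ 5 * p.armVar D x t i := by
  rw [Params.armVarEst, Params.armVar_eq_sum_pairRounds, Finset.mul_sum]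
  refine Finset.sum_le_sum fun j _ => ?_
  by_cases hcard : (pairRounds x p.prep t i j).card = 0
  · simp [hcard]
  · have hvar := h.pooledVar_le_sd_sq ht htT (h.mem_surviving_of_card_ne_zero htT hcard)
    rw [mul_left_comm]
    gcongr

lemma le_armVar_of_start₃_le (h : AdaptiveRun p mu D x i₀ i₁ k) {t : ℕ} (ht : p.start₃ x ≤ t)
    (i : Fin K) : 0.6 * (p.eta ^ 2 * p.logArm K) ≤ p.armVar D x t i := by
  obtain ⟨j, -, hsd, hcard⟩ := h.exists_le_card_pairRounds
  calc 0.6 * (p.eta ^ 2 * p.logArm K)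
      ≤ 0.6 * (((pairRounds x p.prep t i j).card : ℝ) * p.c ^ 2) :=
        mul_le_mul_of_nonneg_left (hcard t ht i) (by norm_num)
    _ = ((pairRounds x p.prep t i j).card : ℝ) * (0.6 * p.c ^ 2) := by ring
    _ ≤ ((pairRounds x p.prep t i j).card : ℝ) * sd (D j) ^ 2 := by gcongr
    _ ≤ p.armVar D x t i := by
        rw [Params.armVar_eq_sum_pairRounds]
        exact Finset.single_le_sum
          (f := fun j => ((pairRounds x p.prep t i j).card : ℝ) * sd (D j) ^ 2)
          (fun _ _ => by positivity) (Finset.mem_univ j)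

/-- The first queries of the source chosen for the initial exploration have variance of order
`c²` and are better estimated than the others, hence the additive term. -/
lemma armVar_le_armVarEst (h : AdaptiveRun p mu D x i₀ i₁ k) {t : ℕ} (ht : p.start₃ x ≤ t)
    (htT : t < p.T) (i : Fin K) :
    0.36 * p.armVar D x t i + 0.084 * (p.eta ^ 2 * p.logArm K) ≤ p.armVarEst x t i := by
  obtain ⟨j, hj, hsd, hcard⟩ := h.exists_le_card_pairRounds
  set excess := fun l => ((pairRounds x p.prep t i l).card : ℝ)
    * (pooledVar x p.prep t l - 0.36 * sd (D l) ^ 2) with hexcess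
  have excess_nonneg : ∀ l, 0 ≤ excess l := by
    intro l
    by_cases hl : (pairRounds x p.prep t i l).card = 0
    · simp [hexcess, hl]
    · exact mul_nonneg (Nat.cast_nonneg _) (sub_nonneg.2
        (h.sd_sq_le_pooledVar ht htT (h.mem_surviving_of_card_ne_zero htT hl)))
  have hsum : p.armVarEst x t i - 0.36 * p.armVar D x t i = ∑ l, excess l := by
    rw [Params.armVar_eq_sum_pairRounds, Params.armVarEst, Finset.mul_sum,
      ← Finset.sum_sub_distrib]
    exact Finset.sum_congr rfl fun l _ => by simp only [hexcess]; ring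
  suffices 0.084 * (p.eta ^ 2 * p.logArm K) ≤ ∑ l, excess l by linarith
  calc 0.084 * (p.eta ^ 2 * p.logArm K)
      ≤ 0.084 * (((pairRounds x p.prep t i j).card : ℝ) * p.c ^ 2) :=
        mul_le_mul_of_nonneg_left (hcard t ht i) (by norm_num)
    _ = ((pairRounds x p.prep t i j).card : ℝ) * (0.14 * (0.6 * p.c ^ 2)) := by ring
    _ ≤ excess j := by
        simp only [hexcess]
        gcongr
        linarith [h.half_sd_sq_le_pooledVar ht htT hj hsd]
    _ ≤ ∑ l, excess l :=
        Finset.single_le_sum (fun l _ => excess_nonneg l) (Finset.mem_univ j)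

end VarianceEstimates

end AdaptiveRun

lemma armExponent_card_armRounds {K M : ℕ} {p : Params M} (mu : Fin K → ℝ) (D : Fin M → Measure ℝ)
    (x : ℕ → Round K M) {t : ℕ} (htT : t ≤ p.T) (i : Fin K) (l : ℝ) :
    armExponent mu D p.eta x p.prep p.T i (armRounds x p.prep t i).card l
      = l * ∑ s ∈ armRounds x p.prep t i, resid mu x s
        - l ^ 2 * (1 / 2 + 2 * (|l| * p.eta) / 9) * p.armVar D x t i := by
  rw [armExponent, firstPulls_card_armRounds _ htT, Finset.sum_sub_distrib, ← Finset.mul_sum,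
    ← Finset.mul_sum, Params.armVar]

lemma Params.tilt_eq_one_or_sq_mul_scale_eq {M : ℕ} (p : Params M) (D : Fin M → Measure ℝ)
    {K N : ℕ} {z : ℝ} (hz : 0 ≤ z) (hscale : 0 < p.scale D K N) :
    (p.tilt D K z N = 1 ∧ p.scale D K N ≤ z ^ 2) ∨
      p.tilt D K z N ^ 2 * p.scale D K N = z ^ 2 := by
  have hsqrt := Real.sqrt_pos.2 hscale
  rcases le_total 1 (z / Real.sqrt (p.scale D K N)) with hle | hle
  · exact .inl ⟨min_eq_left hle, (Real.sqrt_le_left hz).1 ((one_le_div hsqrt).1 hle)⟩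
  · right
    rw [Params.tilt, min_eq_right hle, div_pow, Real.sq_sqrt hscale.le,
      div_mul_cancel₀ _ hscale.ne']

lemma one_add_sq_mul_sq_le {h y : ℝ} (h₀ : 0 ≤ h) (h₁ : h ≤ 1)
    (hy : (h = 1 ∧ 0.6 ≤ y ∧ y ≤ 2.32) ∨ (0.81 ≤ h ^ 2 * y ∧ h ^ 2 * y ≤ 2.32)) :
    (1 + h ^ 2 * y * (1 / 2 + 2 * h / 9)) ^ 2 ≤ 8 * h ^ 2 * (0.36 * y + 0.084) := by
  rcases hy with ⟨rfl, hlow, hup⟩ | ⟨hlow, hup⟩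
  · nlinarith
  · rw [show 8 * h ^ 2 * (0.36 * y + 0.084) = 2.88 * (h ^ 2 * y) + 0.672 * h ^ 2 by ring]
    set q := h ^ 2 * y
    have hq : 0 ≤ (1 / 2 + 2 * h / 9) ^ 2 * ((q - 0.81) * (2.32 - q)) :=
      mul_nonneg (sq_nonneg _) (mul_nonneg (by linarith) (by linarith))
    nlinarith [mul_nonneg h₀ (sub_nonneg.2 h₁), mul_nonneg (mul_nonneg h₀ h₀) (sub_nonneg.2 h₁),
      mul_nonneg (sub_nonneg.2 hlow) h₀, mul_nonneg (sub_nonneg.2 hlow) (sub_nonneg.2 h₁),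
      mul_nonneg (sub_nonneg.2 hup) h₀, mul_nonneg (sub_nonneg.2 hup) (sub_nonneg.2 h₁),
      mul_nonneg (mul_nonneg (sub_nonneg.2 hup) h₀) (sub_nonneg.2 h₁),
      mul_nonneg (mul_nonneg (sub_nonneg.2 hlow) h₀) (sub_nonneg.2 h₁), sq_nonneg (h - 0.4)]

namespace AdaptiveRun

variable {K M : ℕ} {p : Params M} {mu : Fin K → ℝ} {D : Fin M → Measure ℝ}
  {x : ℕ → Round K M} {i₀ i₁ k : Fin K}

section ConfidenceBounds

lemma sdMin_pos (h : AdaptiveRun p mu D x i₀ i₁ k) : 0 < sdMin D := by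
  have hsq := (mul_pos (by norm_num) (pow_pos h.c_pos 2)).trans_le h.le_sdMin_sq
  exact (sdMin_nonneg D).lt_of_ne' (sq_pos_iff.1 hsq)

lemma scale_mul (h : AdaptiveRun p mu D x i₀ i₁ k) (N : ℕ) :
    p.scale D K N * (p.eta ^ 2 * p.logArm K) = N * sdMin D ^ 2 := by
  have hlog := h.logArm_pos
  have heta := h.eta_pos
  rw [Params.scale]
  field_simp

lemma le_scale (h : AdaptiveRun p mu D x i₀ i₁ k) {t : ℕ} (ht : p.start₃ x ≤ t) (i : Fin K) :
    0.35 ≤ p.scale D K (armRounds x p.prep t i).card := by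
  refine le_of_mul_le_mul_right ?_ (mul_pos (pow_pos h.eta_pos 2) h.logArm_pos)
  rw [h.scale_mul]
  calc 0.35 * (p.eta ^ 2 * p.logArm K)
      ≤ 0.35 * (((armRounds x p.prep t i).card : ℝ) * p.c ^ 2) :=
        mul_le_mul_of_nonneg_left (h.le_card_armRounds ht i) (by norm_num)
    _ = ((armRounds x p.prep t i).card : ℝ) * (0.35 * p.c ^ 2) := by ring
    _ ≤ _ := by gcongr; exact h.le_sdMin_sq

lemma tilt_pos (h : AdaptiveRun p mu D x i₀ i₁ k) {t : ℕ} (ht : p.start₃ x ≤ t) (i : Fin K)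
    {z : ℝ} (hz : 0 < z) : 0 < p.tilt D K z (armRounds x p.prep t i).card :=
  lt_min one_pos (div_pos hz (Real.sqrt_pos.2 (by linarith [h.le_scale ht i])))

lemma sq_log_add_armVar_le (h : AdaptiveRun p mu D x i₀ i₁ k) {t : ℕ} (ht : p.start₃ x ≤ t)
    (htT : t < p.T) (i : Fin K) {a : ℝ} (ha : a = p.tilt D K 0.9 (armRounds x p.prep t i).card) :
    (p.logArm K + (a / p.eta) ^ 2 * (1 / 2 + 2 * a / 9) * p.armVar D x t i) ^ 2
      ≤ 8 * (a / p.eta) ^ 2 * p.logArm K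
        * (0.36 * p.armVar D x t i + 0.084 * (p.eta ^ 2 * p.logArm K)) := by
  have hlog := h.logArm_pos
  have heta := h.eta_pos
  have hG : 0 < p.eta ^ 2 * p.logArm K := by positivity
  have hscale := h.le_scale ht i
  have hscale_mul := h.scale_mul (armRounds x p.prep t i).card
  set u := p.scale D K (armRounds x p.prep t i).card
  obtain ⟨y, hy⟩ : ∃ y, p.armVar D x t i = y * (p.eta ^ 2 * p.logArm K) :=
    ⟨p.armVar D x t i / (p.eta ^ 2 * p.logArm K), by field_simp⟩
  have le_y : 0.6 ≤ y := le_of_mul_le_mul_right (hy ▸ h.le_armVar_of_start₃_le ht i) hG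
  have y_le : y ≤ 20 / 7 * u := by
    refine le_of_mul_le_mul_right (hy ▸ (h.armVar_le htT i).trans_eq ?_) hG
    linear_combination -20 / 7 * hscale_mul
  have u_le : u ≤ y :=
    le_of_mul_le_mul_right (hscale_mul.trans_le (hy ▸ Params.le_armVar D t i)) hG
  have hpoly : (1 + a ^ 2 * y * (1 / 2 + 2 * a / 9)) ^ 2 ≤ 8 * a ^ 2 * (0.36 * y + 0.084) := by
    refine one_add_sq_mul_sq_le (ha ▸ (h.tilt_pos ht i (by norm_num)).le)
      (ha ▸ p.tilt_le_one D _ _) ?_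
    obtain ⟨htilt, hu⟩ | htilt :=
      p.tilt_eq_one_or_sq_mul_scale_eq D (z := 0.9) (by norm_num) (by linarith : 0 < u)
    · exact .inl ⟨ha.trans htilt, le_y, by linarith⟩
    · rw [← ha] at htilt
      refine .inr ⟨?_, ?_⟩ <;> nlinarith [sq_nonneg a]
  calc (p.logArm K + (a / p.eta) ^ 2 * (1 / 2 + 2 * a / 9) * p.armVar D x t i) ^ 2
      = p.logArm K ^ 2 * (1 + a ^ 2 * y * (1 / 2 + 2 * a / 9)) ^ 2 := by
        rw [hy]; field_simp
    _ ≤ p.logArm K ^ 2 * (8 * a ^ 2 * (0.36 * y + 0.084)) := by gcongr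
    _ = _ := by rw [hy]; field_simp

lemma neg_sum_resid_le (h : AdaptiveRun p mu D x i₀ i₁ k) {t : ℕ} (ht : p.start₃ x ≤ t)
    (htT : t < p.T) :
    -∑ s ∈ armRounds x p.prep t k, resid mu x s
      ≤ 2 * Real.sqrt (2 * p.logArm K * p.armVarEst x t k) := by
  have hlog := h.logArm_pos
  have heta := h.eta_pos
  have hexp := h.concentrated.best_lower _ (card_armRounds_lt (x := x) p.prep htT k)
  have hsq := h.sq_log_add_armVar_le ht htT k rfl
  have hest := h.armVar_le_armVarEst ht htT k
  have htilt := h.tilt_pos ht k (z := 0.9) (by norm_num)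
  rw [armExponent_card_armRounds mu D x htT.le, abs_neg,
    Params.abs_tilt_div_mul D heta (by norm_num), neg_sq] at hexp
  set a := p.tilt D K 0.9 (armRounds x p.prep t k).card
  have hroot : 0 ≤ 2 * p.logArm K * p.armVarEst x t k := by
    have hvar := Params.armVar_nonneg (p := p) (x := x) D t k
    exact mul_nonneg (by positivity) (le_trans (by positivity) hest)
  have hradius : p.logArm K + (a / p.eta) ^ 2 * (1 / 2 + 2 * a / 9) * p.armVar D x t k
      ≤ a / p.eta * (2 * Real.sqrt (2 * p.logArm K * p.armVarEst x t k)) := by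
    refine le_of_sq_le_sq ?_ (by positivity)
    rw [mul_pow, mul_pow, Real.sq_sqrt hroot]
    refine hsq.trans ((mul_le_mul_of_nonneg_left hest (by positivity)).trans_eq ?_)
    ring
  refine le_of_mul_le_mul_left ?_ (div_pos htilt heta)
  linarith

lemma sqrt_card_mul_logArm (h : AdaptiveRun p mu D x i₀ i₁ k) (N : ℕ) :
    Real.sqrt (N * p.logArm K) * sdMin D
      = Real.sqrt (p.scale D K N) * (p.eta * p.logArm K) := by
  have hlog := h.logArm_pos
  have heta := h.eta_pos
  rw [← Real.sqrt_mul_self h.sdMin_pos.le, ← Real.sqrt_mul (by positivity),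
    ← Real.sqrt_mul_self (by positivity : 0 ≤ p.eta * p.logArm K),
    ← Real.sqrt_mul' _ (by positivity)]
  congr 1
  linear_combination -p.logArm K * h.scale_mul N

lemma sum_resid_le (h : AdaptiveRun p mu D x i₀ i₁ k) {t : ℕ} (ht : p.start₃ x ≤ t)
    (htT : t < p.T) (i : Fin K) :
    ∑ s ∈ armRounds x p.prep t i, resid mu x s
      ≤ 7 * (Real.sqrt ((armRounds x p.prep t i).card * p.logArm K) * sdMin D) := by
  have hlog := h.logArm_pos
  have heta := h.eta_pos
  have hexp := h.concentrated.arm_upper i _ (card_armRounds_lt (x := x) p.prep htT i)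
  have hscale := h.le_scale ht i
  have htilt := h.tilt_pos ht i one_pos
  have htilt_le := p.tilt_le_one (K := K) D 1 (armRounds x p.prep t i).card
  have hcases := p.tilt_eq_one_or_sq_mul_scale_eq (K := K) (N := (armRounds x p.prep t i).card) D
    zero_le_one (by linarith)
  rw [armExponent_card_armRounds mu D x htT.le, Params.abs_tilt_div_mul D heta zero_le_one] at hexp
  rw [h.sqrt_card_mul_logArm]
  have hvar := h.armVar_le htT i
  rw [mul_left_comm, ← h.scale_mul] at hvar
  have hvar_nonneg := Params.armVar_nonneg (p := p) (x := x) D t i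
  set u := p.scale D K (armRounds x p.prep t i).card
  set a := p.tilt D K 1 (armRounds x p.prep t i).card
  have hau : 0.35 ≤ a ^ 2 * u ∧ a ^ 2 * u ≤ 1 := by
    obtain ⟨ha, hu⟩ | ha := hcases
    · rw [ha]
      constructor <;> linarith
    · rw [ha]
      norm_num
  have hpenalty :
      (a / p.eta) ^ 2 * (1 / 2 + 2 * a / 9) * p.armVar D x t i ≤ 2.07 * p.logArm K := by
    calc (a / p.eta) ^ 2 * (1 / 2 + 2 * a / 9) * p.armVar D x t i
        ≤ (a / p.eta) ^ 2 * (1 / 2 + 2 * 1 / 9) * (20 / 7 * (u * (p.eta ^ 2 * p.logArm K))) := by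
          gcongr
      _ = 130 / 63 * (a ^ 2 * u) * p.logArm K := by field_simp; norm_num
      _ ≤ 2.07 * p.logArm K := by gcongr; linarith
  have hradius : 4.07 ≤ 7 * (a * Real.sqrt u) := by
    refine le_of_sq_le_sq ?_ (by positivity)
    rw [mul_pow, mul_pow, Real.sq_sqrt (by linarith)]
    linarith
  refine le_of_mul_le_mul_left ?_ (div_pos htilt heta)
  calc _ ≤ 4.07 * p.logArm K := by linarith
    _ ≤ 7 * (a * Real.sqrt u) * p.logArm K := by gcongr
    _ = _ := by field_simp

lemma UCB_eq (h : AdaptiveRun p mu D x i₀ i₁ k) {t : ℕ} (ht : p.start₃ x ≤ t) (i : Fin K) :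
    p.UCB x t i = mu i + (∑ s ∈ armRounds x p.prep t i, resid mu x s
      + 2 * Real.sqrt (2 * p.logArm K * p.armVarEst x t i)) / (armRounds x p.prep t i).card := by
  rw [Params.UCB, armMean_eq mu x p.prep t i (Finset.card_pos.1 (h.card_armRounds_pos ht i)), avg,
    Params.armVarEst]
  ring

theorem best_le_UCB (h : AdaptiveRun p mu D x i₀ i₁ k) {t : ℕ} (ht : p.start₃ x ≤ t)
    (htT : t < p.T) : mu k ≤ p.UCB x t k := by
  rw [h.UCB_eq ht, le_add_iff_nonneg_right]
  exact div_nonneg (by linarith [h.neg_sum_resid_le ht htT]) (Nat.cast_nonneg _)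

lemma gap_eq (h : AdaptiveRun p mu D x i₀ i₁ k) (i : Fin K) : gap mu i = mu k - mu i := by
  have : Nonempty (Fin K) := ⟨k⟩
  rw [gap, le_antisymm (ciSup_le h.le_best) (le_ciSup (Set.finite_range mu).bddAbove k)]

theorem card_mul_gap_le (h : AdaptiveRun p mu D x i₀ i₁ k) {t : ℕ} (ht : p.start₃ x ≤ t)
    (htT : t < p.T) :
    (armRounds x p.prep t (x t).1).card * gap mu (x t).1
      ≤ 18 * (Real.sqrt ((armRounds x p.prep t (x t).1).card * p.logArm K) * sdMin D) := by
  have hlog := h.logArm_pos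
  have hsd := h.sdMin_pos
  set i := (x t).1
  have hUCB := (h.best_le_UCB ht htT).trans ((h.isRun.adaptive t htT ht).1 k)
  rw [h.UCB_eq ht, ← sub_le_iff_le_add', ← h.gap_eq,
    le_div_iff₀ (by exact_mod_cast h.card_armRounds_pos ht i), mul_comm] at hUCB
  have hvar := (h.armVarEst_le ht htT i).trans
    (mul_le_mul_of_nonneg_left (h.armVar_le htT i) (by norm_num))
  set n := ((armRounds x p.prep t i).card : ℝ)
  have hradius : Real.sqrt (2 * p.logArm K * p.armVarEst x t i)
      ≤ 5.4 * (Real.sqrt (n * p.logArm K) * sdMin D) := by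
    refine Real.sqrt_le_iff.2 ⟨by positivity, ?_⟩
    rw [mul_pow, mul_pow, Real.sq_sqrt (by positivity)]
    have hpos : 0 ≤ n * p.logArm K * sdMin D ^ 2 := by positivity
    calc _ ≤ 2 * p.logArm K * (5 * (n * (20 / 7 * sdMin D ^ 2))) := by gcongr
      _ ≤ _ := by linarith
  have hpos : 0 ≤ Real.sqrt (n * p.logArm K) * sdMin D := by positivity
  linarith [h.sum_resid_le ht htT i]

end ConfidenceBounds

end AdaptiveRun

section Gaps

variable {K M : ℕ}

lemma gap_nonneg (mu : Fin K → ℝ) (i : Fin K) : 0 ≤ gap mu i :=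
  sub_nonneg.2 (le_ciSup (Set.finite_range mu).bddAbove i)

lemma gap_le {mu : Fin K → ℝ} {muBar : ℝ} (hmu : ∀ i, mu i ∈ Set.Icc 0 muBar) (i : Fin K) :
    gap mu i ≤ muBar := by
  have : Nonempty (Fin K) := ⟨i⟩
  rw [gap]
  linarith [ciSup_le fun k => (hmu k).2, (hmu i).1]

lemma gapSum_nonneg (mu : Fin K → ℝ) (D : Fin M → Measure ℝ) (gamma : ℝ) :
    0 ≤ gapSum mu D gamma :=
  Finset.sum_nonneg fun i _ => div_nonneg (sq_nonneg _) (gap_nonneg mu i)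

lemma gapSum_mono (mu : Fin K → ℝ) (D : Fin M → Measure ℝ) {gamma gamma' : ℝ} (h₀ : 0 ≤ gamma)
    (h : gamma ≤ gamma') : gapSum mu D gamma ≤ gapSum mu D gamma' := by
  have hsd := sdMin_nonneg D
  refine Finset.sum_le_sum fun i _ => ?_
  have hgap := gap_nonneg mu i
  gcongr

end Gaps

section AdaptivePhase

lemma sum_comp_arm {K M : ℕ} (x : ℕ → Round K M) (a t : ℕ) (f : Fin K → ℝ) :
    ∑ s ∈ Finset.Ico a t, f (x s).1 = ∑ i, (armRounds x a t i).card * f i := by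
  rw [← Finset.sum_fiberwise (Finset.Ico a t) fun s => (x s).1]
  refine Finset.sum_congr rfl fun i _ => ?_
  rw [← nsmul_eq_mul, ← Finset.sum_const]
  exact Finset.sum_congr rfl fun s hs => by rw [(Finset.mem_filter.1 hs).2]

lemma exists_card_armRounds_le {K M : ℕ} (x : ℕ → Round K M) {a b T : ℕ} (hab : a ≤ b) (i : Fin K)
    (hne : (armRounds x b T i).Nonempty) :
    ∃ t, b ≤ t ∧ t < T ∧ (x t).1 = i ∧
      (armRounds x b T i).card ≤ (armRounds x a t i).card + 1 := by
  obtain ⟨htb, hti⟩ := Finset.mem_filter.1 ((armRounds x b T i).max'_mem hne)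
  rw [Finset.mem_Ico] at htb
  refine ⟨_, htb.1, htb.2, hti, (Finset.card_le_card fun s hs => ?_).trans
    (Finset.card_insert_le ((armRounds x b T i).max' hne) _)⟩
  obtain ⟨hsb, hsi⟩ := Finset.mem_filter.1 hs
  rw [Finset.mem_insert]
  exact (Finset.le_max' _ s hs).eq_or_lt.imp_right fun hst =>
    Finset.mem_filter.2 ⟨Finset.mem_Ico.2 ⟨hab.trans (Finset.mem_Ico.1 hsb).1, hst⟩, hsi⟩

namespace AdaptiveRun

variable {K M : ℕ} {p : Params M} {mu : Fin K → ℝ} {D : Fin M → Measure ℝ}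
  {x : ℕ → Round K M} {i₀ i₁ k : Fin K}

theorem card_armRounds_mul_gap_sq_le (h : AdaptiveRun p mu D x i₀ i₁ k) (i : Fin K) :
    (armRounds x (p.start₃ x) p.T i).card * gap mu i ^ 2
      ≤ 648 * (p.logArm K * sdMin D ^ 2) := by
  have hlog := h.logArm_pos
  rcases (armRounds x (p.start₃ x) p.T i).eq_empty_or_nonempty with hempty | hne
  · rw [hempty, Finset.card_empty, Nat.cast_zero, zero_mul]
    positivity
  obtain ⟨t, ht, htT, rfl, hcard⟩ := exists_card_armRounds_le x
    (Params.prep_le_start₂.trans Params.start₂_le_start₃ : p.prep ≤ p.start₃ x) i hne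
  have hpos := h.card_armRounds_pos ht (x t).1
  have hgap := gap_nonneg mu (x t).1
  have hsq := pow_le_pow_left₀ (by positivity) (h.card_mul_gap_le ht htT) 2
  set n := (armRounds x p.prep t (x t).1).card
  rw [mul_pow, mul_pow, mul_pow, Real.sq_sqrt (by positivity)] at hsq
  have hn : (0 : ℝ) < n := by exact_mod_cast hpos
  have hbefore : n * gap mu (x t).1 ^ 2 ≤ 324 * (p.logArm K * sdMin D ^ 2) :=
    le_of_mul_le_mul_left (by linarith) hn
  have hdouble : ((armRounds x (p.start₃ x) p.T (x t).1).card : ℝ) ≤ 2 * n := by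
    exact_mod_cast hcard.trans (by omega)
  calc _ ≤ 2 * n * gap mu (x t).1 ^ 2 := by gcongr
    _ ≤ _ := by linarith

theorem adaptive_regret_le_gapSum (h : AdaptiveRun p mu D x i₀ i₁ k) :
    ∑ s ∈ Finset.Ico (p.start₃ x) p.T, gap mu (x s).1
      ≤ 648 * p.logArm K * gapSum mu D 0 := by
  rw [sum_comp_arm, gapSum, Finset.mul_sum, Finset.sum_filter]
  refine Finset.sum_le_sum fun i _ => ?_
  split_ifs with hi
  · rw [mul_div_assoc', le_div_iff₀ hi, add_zero, mul_assoc, ← sq, mul_assoc]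
    exact h.card_armRounds_mul_gap_sq_le i
  · rw [(not_lt.1 hi).antisymm (gap_nonneg mu i), mul_zero]

theorem adaptive_regret_le_sqrt (h : AdaptiveRun p mu D x i₀ i₁ k) :
    ∑ s ∈ Finset.Ico (p.start₃ x) p.T, gap mu (x s).1
      ≤ 26 * Real.sqrt (p.logArm K) * (sdMin D * Real.sqrt (K * p.T)) := by
  have hlog := h.logArm_pos
  have hsd := sdMin_nonneg D
  have hsum : ∑ s ∈ Finset.Ico (p.start₃ x) p.T, gap mu (x s).1 ^ 2
      ≤ K * (648 * (p.logArm K * sdMin D ^ 2)) := by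
    rw [sum_comp_arm x _ _ fun i => gap mu i ^ 2]
    refine (Finset.sum_le_card_nsmul _ _ _ fun i _ => h.card_armRounds_mul_gap_sq_le i).trans_eq ?_
    rw [Finset.card_univ, Fintype.card_fin, nsmul_eq_mul]
  have hcard : ((Finset.Ico (p.start₃ x) p.T).card : ℝ) ≤ p.T := by
    rw [Nat.card_Ico]
    exact_mod_cast Nat.sub_le _ _
  refine le_of_sq_le_sq ?_ (by positivity)
  calc _ ≤ ((Finset.Ico (p.start₃ x) p.T).card : ℝ)
        * ∑ s ∈ Finset.Ico (p.start₃ x) p.T, gap mu (x s).1 ^ 2 := sq_sum_le_card_mul_sum_sq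
    _ ≤ p.T * (K * (648 * (p.logArm K * sdMin D ^ 2))) := by gcongr
    _ = 648 * (p.logArm K * (sdMin D ^ 2 * (K * p.T))) := by ring
    _ ≤ 676 * (p.logArm K * (sdMin D ^ 2 * (K * p.T))) := by gcongr; norm_num
    _ = _ := by
        rw [mul_pow, mul_pow, mul_pow, Real.sq_sqrt hlog.le, Real.sq_sqrt (by positivity)]
        ring

end AdaptiveRun

end AdaptivePhase

section ExplorationCost

variable {K M : ℕ} {p : Params M}

/-- `log (3 K M T / δ)`, the logarithm of the final bounds, which dominates those of the
algorithm. -/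
noncomputable def Params.logTotal (p : Params M) (K : ℕ) : ℝ :=
  Real.log (3 * K * M * p.T / p.delta)

lemma Params.three_le_div_delta (hK : 0 < K) (hM : 0 < M) (hT : 0 < p.T) (hdelta : 0 < p.delta)
    (hdelta1 : p.delta < 1) : 3 ≤ 3 * K * M * p.T / p.delta := by
  have hKMT : (1 : ℝ) ≤ K * M * p.T := by exact_mod_cast Nat.mul_pos (Nat.mul_pos hK hM) hT
  rw [le_div_iff₀ hdelta]
  linarith

lemma Params.one_le_logTotal (hK : 0 < K) (hM : 0 < M) (hT : 0 < p.T) (hdelta : 0 < p.delta)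
    (hdelta1 : p.delta < 1) : 1 ≤ p.logTotal K := by
  rw [Params.logTotal, Real.le_log_iff_exp_le (by positivity)]
  linarith [Real.exp_one_lt_d9, Params.three_le_div_delta hK hM hT hdelta hdelta1]

lemma Params.logArm_le_logTotal (hK : 0 < K) (hM : 0 < M) (hT : 0 < p.T) (hdelta : 0 < p.delta) :
    p.logArm K ≤ p.logTotal K := by
  have hM' : (1 : ℝ) ≤ M := by exact_mod_cast hM
  refine Real.log_le_log (by positivity) (div_le_div_of_nonneg_right ?_ hdelta.le)
  calc (3 * K * p.T : ℝ) = 3 * K * 1 * p.T := by ring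
    _ ≤ 3 * K * M * p.T := by gcongr

lemma Params.logSrc_le_logTotal (hK : 0 < K) (hM : 0 < M) (hT : 0 < p.T) (hdelta : 0 < p.delta) :
    p.logSrc ≤ p.logTotal K := by
  have hK' : (1 : ℝ) ≤ K := by exact_mod_cast hK
  refine Real.log_le_log (by positivity) (div_le_div_of_nonneg_right ?_ hdelta.le)
  calc (3 * M * p.T : ℝ) = 3 * 1 * M * p.T := by ring
    _ ≤ 3 * K * M * p.T := by gcongr

lemma Params.log_twelve_mul_le (hK : 0 < K) (hM : 0 < M) (hT : 0 < p.T) (hdelta : 0 < p.delta)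
    (hdelta1 : p.delta < 1) : Real.log (12 * M / p.delta) ≤ 3 * p.logTotal K := by
  have hthree := Params.three_le_div_delta hK hM hT hdelta hdelta1
  have hM_le : 3 * M / p.delta ≤ 3 * K * M * p.T / p.delta := by
    have hKT : (1 : ℝ) ≤ K * p.T := by exact_mod_cast Nat.mul_pos hK hT
    refine div_le_div_of_nonneg_right ?_ hdelta.le
    calc (3 * M : ℝ) = 3 * M * 1 := (mul_one _).symm
      _ ≤ 3 * M * (K * p.T) := by gcongr
      _ = 3 * K * M * p.T := by ring
  rw [Params.logTotal]
  set y := 3 * K * M * p.T / p.delta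
  have hcube : 12 * M / p.delta ≤ y ^ 3 :=
    calc 12 * M / p.delta = 4 * (3 * M / p.delta) := by ring
      _ ≤ 3 ^ 2 * y := by gcongr; norm_num
      _ ≤ y ^ 2 * y := by gcongr
      _ = y ^ 3 := by ring
  calc Real.log (12 * M / p.delta) ≤ Real.log (y ^ 3) := Real.log_le_log (by positivity) hcube
    _ = 3 * Real.log y := by rw [Real.log_pow]; norm_num

lemma Params.minBudget_le_logTotal (hK : 0 < K) (hM : 0 < M) (hT : 0 < p.T)
    (hdelta : 0 < p.delta) (hdelta1 : p.delta < 1) :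
    p.minBudget ≤ 3072 * p.logTotal K * (p.eta ^ 4 / p.c ^ 4) := by
  calc p.minBudget = 1024 * (p.eta ^ 4 / p.c ^ 4) * Real.log (12 * M / p.delta) := by
        rw [Params.minBudget]; ring
    _ ≤ 1024 * (p.eta ^ 4 / p.c ^ 4) * (3 * p.logTotal K) := by
        gcongr
        exact Params.log_twelve_mul_le hK hM hT hdelta hdelta1
    _ = _ := by ring

lemma Params.alpha_le (hK : 0 < K) (hM : 0 < M) (hT : 0 < p.T) (hdelta : 0 < p.delta)
    (hdelta1 : p.delta < 1) : (p.alpha K : ℝ) ≤ p.logTotal K * (p.eta ^ 2 / p.c ^ 2) + 1 := by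
  have hlog : p.eta ^ 2 * p.logArm K / p.c ^ 2 ≤ p.logTotal K * (p.eta ^ 2 / p.c ^ 2) := by
    rw [mul_div_right_comm, mul_comm]
    gcongr
    exact Params.logArm_le_logTotal hK hM hT hdelta
  have hlog_total := Params.one_le_logTotal hK hM hT hdelta hdelta1
  exact (Nat.ceil_le_ceil hlog |> Nat.cast_le.2).trans
    (Nat.ceil_lt_add_one (by positivity)).le

lemma Params.beta_le (hK : 0 < K) (hM : 0 < M) (hT : 0 < p.T) (hdelta : 0 < p.delta)
    (hdelta1 : p.delta < 1) (hnu : 0 < p.nu) :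
    (p.beta K : ℝ)
      ≤ 3 * K + p.logTotal K * (4 * (p.eta ^ 4 / p.nu) + 16 * (p.eta ^ 4 / p.c ^ 4)) := by
  have hK' : (1 : ℝ) ≤ K := by exact_mod_cast hK
  have hlog_total := Params.one_le_logTotal hK hM hT hdelta hdelta1
  have hlog : 2 * K + 4 * p.eta ^ 4 * p.logSrc / p.nu + 16 * p.eta ^ 4 * p.logSrc / p.c ^ 4
      ≤ 2 * K + p.logTotal K * (4 * (p.eta ^ 4 / p.nu) + 16 * (p.eta ^ 4 / p.c ^ 4)) := by
    calc _ = 2 * K + p.logSrc * (4 * (p.eta ^ 4 / p.nu) + 16 * (p.eta ^ 4 / p.c ^ 4)) := by ring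
      _ ≤ _ := by gcongr; exact Params.logSrc_le_logTotal hK hM hT hdelta
  refine (Nat.ceil_le_ceil hlog |> Nat.cast_le.2).trans
    ((Nat.ceil_lt_add_one (by positivity)).le.trans ?_)
  linarith

lemma Params.card_surviving_le (x : ℕ → Round K M) : (p.surviving x).card ≤ M :=
  (Finset.card_le_univ _).trans_eq (Fintype.card_fin M)

theorem Params.start₃_le (x : ℕ → Round K M) (hK : 0 < K) (hM : 0 < M) (hT : 0 < p.T)
    (hdelta : 0 < p.delta) (hdelta1 : p.delta < 1) (hnu : 0 < p.nu) :
    (p.start₃ x : ℝ) ≤ M * p.tau + K * (p.logTotal K * (p.eta ^ 2 / p.c ^ 2) + 1)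
      + M * (3 * K + p.logTotal K * (4 * (p.eta ^ 4 / p.nu) + 16 * (p.eta ^ 4 / p.c ^ 4))) := by
  rw [Params.start₃, Params.start₂, Params.prep]
  push_cast
  gcongr
  · exact Params.alpha_le hK hM hT hdelta hdelta1
  · exact Params.card_surviving_le x
  · exact Params.beta_le hK hM hT hdelta hdelta1 hnu

theorem Params.start₃_mul_le (x : ℕ → Round K M) {muBar : ℝ} (hmuBar : 0 ≤ muBar) (hK : 0 < K)
    (hM : 0 < M) (hT : 0 < p.T) (hdelta : 0 < p.delta) (hdelta1 : p.delta < 1) (hnu : 0 < p.nu)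
    (hbudget : p.minBudget ≤ p.tau) :
    p.start₃ x * muBar ≤ 4000 * p.logTotal K * p.exploration K muBar := by
  have hl := Params.one_le_logTotal hK hM hT hdelta hdelta1
  have hstart := Params.start₃_le x hK hM hT hdelta hdelta1 hnu
  have hmin := Params.minBudget_le_logTotal hK hM hT hdelta hdelta1
  have hM' : (1 : ℝ) ≤ M := by exact_mod_cast hM
  have hexploration : p.exploration K muBar = (2 * M * (p.eta ^ 4 / p.c ^ 4)
      + K * (p.eta ^ 2 / p.c ^ 2) + K * M + M * (p.eta ^ 4 / p.nu)
      + M * (p.tau - p.minBudget)) * muBar := by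
    rw [Params.exploration]
    ring
  rw [hexploration, ← mul_assoc]
  refine mul_le_mul_of_nonneg_right (hstart.trans ?_) hmuBar
  have ha : 0 ≤ p.eta ^ 4 / p.c ^ 4 := by positivity
  have hb : 0 ≤ p.eta ^ 2 / p.c ^ 2 := by positivity
  have hd : 0 ≤ p.eta ^ 4 / p.nu := by positivity
  have hexcess : 0 ≤ M * (p.tau - p.minBudget) := mul_nonneg (by linarith) (by linarith)
  set l := p.logTotal K
  set a := p.eta ^ 4 / p.c ^ 4
  set b := p.eta ^ 2 / p.c ^ 2
  set d := p.eta ^ 4 / p.nu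
  have htau : M * p.tau ≤ l * (M * (p.tau - p.minBudget)) + M * (3072 * l * a) := by
    linarith [le_mul_of_one_le_left hexcess hl,
      mul_le_mul_of_nonneg_left hmin (zero_le_one.trans hM')]
  have hKM : (K : ℝ) * M ≤ l * (K * M) := le_mul_of_one_le_left (by positivity) hl
  have hK_le : (K : ℝ) ≤ K * M := le_mul_of_one_le_right (Nat.cast_nonneg K) hM'
  have hexcess' : 0 ≤ l * (M * (p.tau - p.minBudget)) := by positivity
  have hb' : 0 ≤ l * (K * b) := by positivity
  have hd' : 0 ≤ l * (M * d) := by positivity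
  linarith

end ExplorationCost

lemma sum_range_le_mul_add_sum_Ico {f : ℕ → ℝ} {b : ℝ} (hf : ∀ s, f s ∈ Set.Icc 0 b) (m n : ℕ) :
    ∑ s ∈ Finset.range n, f s ≤ m * b + ∑ s ∈ Finset.Ico m n, f s := by
  have hsum : ∀ N, ∑ s ∈ Finset.range N, f s ≤ N * b := fun N =>
    (Finset.sum_le_card_nsmul _ _ _ fun s _ => (hf s).2).trans_eq
      (by rw [Finset.card_range, nsmul_eq_mul])
  have hb : 0 ≤ b := (hf 0).1.trans (hf 0).2
  rcases le_total n m with hnm | hmn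
  · rw [Finset.Ico_eq_empty_of_le hnm, Finset.sum_empty, add_zero]
    exact (hsum n).trans (by gcongr)
  · rw [← Finset.sum_range_add_sum_Ico f hmn]
    gcongr
    exact hsum m

section Regret

variable {K M : ℕ} {p : Params M} {mu : Fin K → ℝ} {D : Fin M → Measure ℝ}
  {x : ℕ → Round K M} {i₀ i₁ k : Fin K}

theorem AdaptiveRun.adaptive_regret_le (h : AdaptiveRun p mu D x i₀ i₁ k) :
    ∑ s ∈ Finset.Ico (p.start₃ x) p.T, gap mu (x s).1
      ≤ 4000 * p.logTotal K * min (gapSum mu D 0) (sdMin D * Real.sqrt (K * p.T)) := by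
  have hK : 0 < K := Fin.pos k
  have hM : 0 < M := by exact_mod_cast zero_lt_one.trans_le h.one_le_M
  have hT : 0 < p.T := h.start₃_lt.pos
  have hl := Params.one_le_logTotal hK hM hT h.delta_pos h.delta_lt_one
  have hlog := Params.logArm_le_logTotal hK hM hT h.delta_pos
  have hlog_pos := h.logArm_pos
  have hsd := sdMin_nonneg D
  have hgapSum := gapSum_nonneg mu D 0
  rw [mul_min_of_nonneg _ _ (by positivity)]
  refine le_min (h.adaptive_regret_le_gapSum.trans ?_) (h.adaptive_regret_le_sqrt.trans ?_)
  · gcongr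
    norm_num
  · have hsqrt : Real.sqrt (p.logArm K) ≤ p.logTotal K :=
      Real.sqrt_le_iff.2 ⟨by positivity, by nlinarith⟩
    gcongr
    norm_num

theorem sum_gap_le {muBar : ℝ} (hM : 0 < M) (hT : 0 < p.T) (hdelta : 0 < p.delta)
    (hdelta1 : p.delta < 1) (hc : 0 < p.c) (hnu : 0 < p.nu) (htau : 1 ≤ p.tau)
    (hbudget : p.minBudget ≤ p.tau) (hmu : ∀ i, mu i ∈ Set.Icc 0 muBar)
    (hD : NoiseLaws D p.eta) (heta : 0 < p.eta) (hrun : p.IsRun x i₀ i₁)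
    (hk : ∀ i, mu i ≤ mu k) (hconc : Concentrated p mu D x k)
    (hex : ∃ j ∈ p.surviving x, p.c ^ 2 ≤ sd (D j) ^ 2) :
    ∑ s ∈ Finset.range p.T, gap mu (x s).1 ≤ 4000 * p.logTotal K *
      (p.exploration K muBar + min (gapSum mu D 0) (sdMin D * Real.sqrt (K * p.T))) := by
  have hl := Params.one_le_logTotal (Fin.pos k) hM hT hdelta hdelta1
  have hsd := sdMin_nonneg D
  have hgapSum := gapSum_nonneg mu D 0
  have hadaptive : ∑ s ∈ Finset.Ico (p.start₃ x) p.T, gap mu (x s).1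
      ≤ 4000 * p.logTotal K * min (gapSum mu D 0) (sdMin D * Real.sqrt (K * p.T)) := by
    rcases le_or_gt p.T (p.start₃ x) with hle | hlt
    · rw [Finset.Ico_eq_empty_of_le hle, Finset.sum_empty]
      positivity
    · exact AdaptiveRun.adaptive_regret_le ⟨hD, heta, hdelta, hdelta1, hc, hnu, htau, hbudget, hrun,
        hconc, hlt, hex, hk⟩
  rw [mul_add]
  exact (sum_range_le_mul_add_sum_Ico (fun s => ⟨gap_nonneg mu _, gap_le hmu _⟩) _ _).trans
    (add_le_add (Params.start₃_mul_le x ((hmu k).1.trans (hmu k).2) (Fin.pos k) hM hT hdelta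
      hdelta1 hnu hbudget) hadaptive)

lemma min_le_separation_add_gapSum {gamma : ℝ} (hgamma : 0 ≤ gamma) (y : ℝ) :
    min (gapSum mu D 0) y ≤ p.separation x D gamma + gapSum mu D gamma :=
  (min_le_left _ _).trans <| (gapSum_mono mu D le_rfl hgamma).trans <|
    le_add_of_nonneg_left (Real.sqrt_nonneg _)

lemma min_le_sdMin_add_mul_sqrt {c : ℝ} (hc : 0 ≤ c) (y z : ℝ) :
    min y (sdMin D * Real.sqrt z) ≤ (sdMin D + c) * Real.sqrt z :=
  (min_le_right _ _).trans (by gcongr; exact le_add_of_nonneg_right hc)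

end Regret

end Soar

theorem mainTheorem1_general (K M : ℕ) (p : Soar.Params M) (muBar : ℝ)
    (mu : Fin K → ℝ) (D : Fin M → Measure ℝ) (i₀ i₁ : Fin K)
    (Ω : Type*) (mΩ : MeasurableSpace Ω) (P : Measure Ω) [IsProbabilityMeasure P]
    (ℱ : Filtration ℕ mΩ) (arm : ℕ → Ω → Fin K) (src : ℕ → Ω → Fin M) (X : ℕ → Ω → ℝ)
    (hT : 1 ≤ p.T) (hdelta : 0 < p.delta) (hdelta1 : p.delta < 1) (hc : 0 < p.c) (hnu : 0 < p.nu)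
    (htau : 1 ≤ p.tau) (hbudget : p.minBudget ≤ p.tau)
    (hmu : ∀ i, mu i ∈ Set.Icc 0 muBar) (hD : Soar.NoiseLaws D p.eta)
    (_ : ∀ j k, p.kappa j = some k → k = centralMoment id 4 (D j))
    (hI : Soar.Interaction P ℱ mu D arm src X)
    (hrun : ∀ ω, p.IsRun (fun t => (arm t ω, src t ω, X t ω)) i₀ i₁) :
    ENNReal.ofReal (1 - p.delta) ≤
      P {ω |
        (∃ j ∈ p.surviving (fun t => (arm t ω, src t ω, X t ω)),
          p.c ^ 2 ≤ Soar.sd (D j) ^ 2) →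
        Soar.regret mu arm p.T ω ≤
          4000 * Real.log (3 * K * M * p.T / p.delta) *
            (p.exploration K muBar +
              min (Soar.gapSum mu D 0) (Soar.sdMin D * Real.sqrt (K * p.T)))} := by
  obtain ⟨ω₀⟩ : Nonempty Ω := nonempty_of_isProbabilityMeasure P
  have hM : 0 < M := Fin.pos (src 0 ω₀)
  have : Nonempty (Fin K) := ⟨i₀⟩
  obtain ⟨k, hk⟩ := Finite.exists_max mu
  rcases le_or_gt p.eta 0 with heta | heta
  · have hsd (j : Fin M) : ¬ p.c ^ 2 ≤ Soar.sd (D j) ^ 2 := by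
      rw [((hD.centeredLaw j).sd_le.trans heta).antisymm (Soar.sd_nonneg _), not_le]
      exact pow_lt_pow_left₀ hc le_rfl two_ne_zero
    simp only [hsd, and_false, exists_false, false_imp_iff, Set.ofPred_true, measure_univ]
    exact ENNReal.ofReal_le_one.2 (by linarith)
  rw [ENNReal.ofReal_sub 1 hdelta.le, ENNReal.ofReal_one, tsub_le_iff_right]
  refine le_trans ?_
    (add_le_add_right (hI.measure_not_concentrated_le hD heta hT hdelta hdelta1 hM k) _)
  rw [← measure_univ (μ := P)]
  refine (measure_mono fun ω _ => ?_).trans (measure_union_le _ _)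
  by_cases hconc : Soar.Concentrated p mu D (Soar.traj arm src X ω) k
  · exact Or.inl (Soar.sum_gap_le hM hT hdelta hdelta1 hc hnu htau hbudget hmu hD heta (hrun ω) hk
      hconc)
  · exact Or.inr hconc

theorem mainTheorem1 (R : ℝ) (hR : 1 ≤ R) :
    ∃ (C : ℝ) (q : ℕ), 0 < C ∧
      ∀ (K M : ℕ) (p : Soar.Params M) (muBar gamma : ℝ)
        (mu : Fin K → ℝ) (D : Fin M → Measure ℝ) (i₀ i₁ : Fin K)
        (Ω : Type*) (mΩ : MeasurableSpace Ω) (P : Measure Ω) (ℱ : Filtration ℕ mΩ)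
        (arm : ℕ → Ω → Fin K) (src : ℕ → Ω → Fin M) (X : ℕ → Ω → ℝ),
        IsProbabilityMeasure P →
        -- parameters
        1 ≤ p.T → 0 < p.delta → p.delta < 1 → 0 < p.c → 0 < p.nu → 0 < gamma →
        1 ≤ p.tau → p.minBudget ≤ p.tau →
        -- the instance
        (∀ i, mu i ∈ Set.Icc 0 muBar) → Soar.NoiseLaws D p.eta →
        (∀ j k, p.kappa j = some k → k = centralMoment id 4 (D j)) →
        -- `c*` is of the order of the standard deviations of the sources
        (∀ j, p.c ≤ R * Soar.sd (D j)) →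
        -- the interaction, with SOAR as the learner
        Soar.Interaction P ℱ mu D arm src X →
        (∀ ω, p.IsRun (fun t => (arm t ω, src t ω, X t ω)) i₀ i₁) →
        ENNReal.ofReal (1 - p.delta) ≤
          P {ω |
            (∃ j ∈ p.surviving (fun t => (arm t ω, src t ω, X t ω)),
              p.c ^ 2 ≤ Soar.sd (D j) ^ 2) →
            Soar.regret mu arm p.T ω ≤
                C * Real.log (3 * K * M * p.T / p.delta) ^ q *
                  (p.exploration K muBar
                    + p.separation (fun t => (arm t ω, src t ω, X t ω)) D gamma
                    + Soar.gapSum mu D gamma) ∧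
            Soar.regret mu arm p.T ω ≤
                C * Real.log (3 * K * M * p.T / p.delta) ^ q *
                  (p.exploration K muBar
                    + (Soar.sdMin D + p.c) * Real.sqrt (K * p.T))} := by
  refine ⟨4000, 1, by norm_num, fun K M p muBar gamma mu D i₀ i₁ Ω mΩ P ℱ arm src X _ hT hdelta
    hdelta1 hc hnu hgamma htau hbudget hmu hD hkappa _ hI hrun =>
    (mainTheorem1_general K M p muBar mu D i₀ i₁ Ω mΩ P ℱ arm src X hT hdelta hdelta1 hc hnu htau
      hbudget hmu hD hkappa hI hrun).trans (measure_mono fun ω hω hex => ?_)⟩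
  have hlog := Soar.Params.one_le_logTotal (Fin.pos i₀) (Fin.pos (src 0 ω)) hT hdelta hdelta1
  have hscale := mul_nonneg (by norm_num : (0 : ℝ) ≤ 4000) (zero_le_one.trans hlog)
  rw [pow_one, add_assoc]
  exact ⟨(hω hex).trans (mul_le_mul_of_nonneg_left (add_le_add_right
      (Soar.min_le_separation_add_gapSum hgamma.le _) _) hscale),
    (hω hex).trans (mul_le_mul_of_nonneg_left (add_le_add_right
      (Soar.min_le_sdMin_add_mul_sqrt hc.le _ _) _) hscale)⟩
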